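/- All graphs are finite and simple. An ordered bigraph $G$ is a bipartite graph with a fixed bipartition $(V_1(G),V_2(G))$, together with a linear order on $V_1(G)$ and a linear order on $V_2(G)$ (no order between the two parts is given). It is an ordered tree bigraph if the underlying graph is a tree. The bicomplement of $G$ is obtained by reversing the adjacency of each pair $v_1,v_2$ with $v_1\in V_1(G)$ and $v_2\in V_2(G)$, keeping the bipartition and the orders. An ordered bigraph $G$ contains an ordered bigraph $H$ if there is an isomorphism from $H$ to an induced subgraph of $G$ that maps $V_i(H)$ into $V_i(G)$ and preserves the order on $V_i(H)$, for $i=1,2$. A pair $(Z_1,Z_2)$ with $Z_i\subseteq V_i(G)$ for $i=1,2$ is pure if either every vertex of $Z_1$ is adjacent to every vertex of $Z_2$, or there are no edges between $Z_1$ and $Z_2$. Theorem. Let $T$ be an ordered tree bigraph. For every real $c>0$ there exists a real $\delta>0$ with the following property. Let $n\ge 1$ be an integer, and let $G$ be an ordered bigraph with $|V_1(G)|,|V_2(G)|\ge n$ that contains neither $T$ nor the bicomplement of $T$. Then there is a pure pair $(Z_1,Z_2)$ with $Z_i\subseteq V_i(G)$ for $i=1,2$, such that either $|Z_1|\ge\delta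 n$ and $|Z_2|\ge\delta n^{1-c}$, or $|Z_1|\ge\delta n^{1-c}$ and $|Z_2|\ge\delta n$. -/

import Mathlib

/-- A bigraph with parts `V₁` and `V₂`: a (simple, bipartite) graph whose bipartition is given by
the two disjoint vertex types `V₁`, `V₂`, recorded by the adjacency between the two parts.
An ordered bigraph is a `Bigraph V₁ V₂` where `V₁` and `V₂` each carry a linear order
(no order between the two parts is given). -/
@[ext]
structure Bigraph (V₁ V₂ : Type*) where
  /-- Adjacency between a vertex of the first part and a vertex of the second part. -/
  Adj : V₁ → V₂ → Prop

namespace Bigraph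

/-- The underlying graph of a bigraph, on the disjoint union of the two parts. -/
def toSimpleGraph {V₁ V₂ : Type*} (G : Bigraph V₁ V₂) : SimpleGraph (V₁ ⊕ V₂) where
  Adj
    | Sum.inl a, Sum.inr b => G.Adj a b
    | Sum.inr b, Sum.inl a => G.Adj a b
    | _, _ => False
  symm := by
    constructor
    rintro (a | b) (a' | b') h <;> exact h
  loopless := by
    constructor
    rintro (a | b) h <;> exact h

/-- A tree bigraph: the underlying graph is a tree. -/
def IsTree {V₁ V₂ : Type*} (G : Bigraph V₁ V₂) : Prop :=
  G.toSimpleGraph.IsTree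

/-- The bicomplement: adjacency between the two parts is reversed. -/
def bicomplement {V₁ V₂ : Type*} (G : Bigraph V₁ V₂) : Bigraph V₁ V₂ where
  Adj a b := ¬ G.Adj a b

/-- The ordered bigraph `G` contains the ordered bigraph `H`: there is an isomorphism from `H` to
an induced subgraph of `G` which respects the two parts and preserves the order on each part. -/
def Contains {V₁ V₂ W₁ W₂ : Type*} [LinearOrder V₁] [LinearOrder V₂] [LinearOrder W₁]
    [LinearOrder W₂] (G : Bigraph V₁ V₂) (H : Bigraph W₁ W₂) : Prop :=
  ∃ (f₁ : W₁ ↪o V₁) (f₂ : W₂ ↪o V₂), ∀ a b, G.Adj (f₁ a) (f₂ b) ↔ H.Adj a b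

/-- `Z₁` and `Z₂` are complete to each other: all edges between them are present. -/
def IsComplete {V₁ V₂ : Type*} (G : Bigraph V₁ V₂) (Z₁ : Finset V₁) (Z₂ : Finset V₂) : Prop :=
  ∀ a ∈ Z₁, ∀ b ∈ Z₂, G.Adj a b

/-- `Z₁` and `Z₂` are anticomplete to each other: there are no edges between them. -/
def IsAnticomplete {V₁ V₂ : Type*} (G : Bigraph V₁ V₂) (Z₁ : Finset V₁) (Z₂ : Finset V₂) :
    Prop :=
  ∀ a ∈ Z₁, ∀ b ∈ Z₂, ¬ G.Adj a b

/-- `(Z₁, Z₂)` is a pure pair: `Z₁` is complete or anticomplete to `Z₂`. -/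
def IsPure {V₁ V₂ : Type*} (G : Bigraph V₁ V₂) (Z₁ : Finset V₁) (Z₂ : Finset V₂) : Prop :=
  G.IsComplete Z₁ Z₂ ∨ G.IsAnticomplete Z₁ Z₂

end Bigraph

/-!
The proof passes to a sparse pair of vertex sets whose maximum degree cannot be lowered cheaply by
shrinking the sets, and builds the tree there, from the leaves to the root.

*Sparsity.* Since `T` is not contained in `G`, there are linear sets `A ⊆ V₁`, `X ⊆ V₂` such that
every vertex of `X` has at most `ε |A|` neighbours in `A`, or at most `ε |A|` nonneighbours
(`exists_sparse_or_dense`). In the second case `G` is replaced by its bicomplement, so the task is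
to find either an anticomplete pair of the required size, or a copy of `T`.

*Resistance.* Put `ν = n ^ (-b)` with a small constant `b > 0`, and let `D` bound the degrees from
`X` to `A`. As long as possible, pass to a constant fraction of `A` and a `ν ^ e` fraction of `X`
such that `D` decreases by a factor `ν ^ (M * e)`, where `M` is a large constant and `e` belongs to
a bounded range of positive integers. After boundedly many rounds either `D < 1`, which is an
anticomplete pair with a linear first set and a second set of size at least `n ^ (1 - c)` up to a
constant factor (the exponent lost is about `1 / M`), or the pair resists shrinking
(`exists_anticomplete_or_resists`). In a resistant pair, any constant fraction `A'` of `A` and any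
`ν ^ e` fraction `X'` of `X` have a vertex in `X'` with degree at least `ν ^ (M * e) * D` to `A'`,
while `D` is an upper bound for all degrees. Since `A` and `X` may be cut into intervals, this
uniformity holds at once for all the sets in which the vertices of the tree are to be placed, and
their order takes care of itself.

*Construction.* Root `T` at a vertex of the second part and process the vertices `u` of its first
part from the bottom upwards, maintaining a set of candidates for every vertex of `T`
(`Rooting.State`). The set of `u` is a linear set, nearly all of whose members have neighbours
in the current sets of the children of `u`. From it, about `|A| / D` vertices are chosen greedily
(`exists_cover`) so that they cover a polynomial fraction `ν ^ (M * e)` of the candidates for the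
parent of `u`, up to a constant factor. Since degrees from `X` are at most `D`, few vertices of `A`
have far more than the average number of neighbours in another set on that side; these are avoided,
so that the chosen vertices cover at most half of each such set, and the covered parts are removed
there. One neighbour of each chosen vertex is kept in the set of each child. As these kept sets have
size `O(|A| / D)`, their neighbourhoods can be removed from all unprocessed sets
(`Resists.exists_step`, `Rooting.State.exists_insert`). Thus sets of nonadjacent vertices of `T`
become anticomplete, and in the end a copy of `T` is selected from the root downwards
(`Rooting.exists_copy`).
-/

/-! ### Rooted trees -/

/-- Rooting a tree at `r` by distance: every other vertex has exactly one neighbour that is closer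
to the root. -/
lemma SimpleGraph.IsTree.exists_depth {V : Type*} {H : SimpleGraph V} (hH : H.IsTree) (r : V) :
    ∃ d : V → ℕ, d r = 0 ∧ (∀ v w, H.Adj v w → d v ≠ d w) ∧
      (∀ v, v ≠ r → ∃ w, H.Adj v w ∧ d w < d v) ∧
      ∀ v w w', H.Adj v w → H.Adj v w' → d w < d v → d w' < d v → w = w' := by
  refine ⟨H.dist r, SimpleGraph.dist_self, fun v w h => hH.dist_ne_of_adj r h, fun v hv => ?_, ?_⟩
  · obtain ⟨q, hq⟩ := hH.connected.exists_walk_length_eq_dist v r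
    cases q with
    | nil => exact absurd rfl hv
    | cons h q' =>
      refine ⟨_, h, ?_⟩
      have h1 := SimpleGraph.dist_le q'
      rw [SimpleGraph.Walk.length_cons] at hq
      rw [SimpleGraph.dist_comm, SimpleGraph.dist_comm (u := r)]
      omega
  · have key : ∀ v w, H.Adj v w → H.dist r w < H.dist r v →
        ∃ q : H.Walk r v, q.IsPath ∧ q.penultimate = w := by
      intro v w h hlt
      obtain ⟨q, hq, hql⟩ := hH.connected.exists_path_of_dist r w
      have hv : v ∉ q.support := by
        intro hv
        have := congrArg SimpleGraph.Walk.length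
          (hH.isAcyclic.path_concat (hH.connected.exists_path_of_dist r v).choose_spec.1 hq h hv)
        rw [SimpleGraph.Walk.length_concat,
          (hH.connected.exists_path_of_dist r v).choose_spec.2] at this
        omega
      exact ⟨q.concat h.symm, hq.concat hv h.symm, SimpleGraph.Walk.penultimate_concat ..⟩
    intro v w w' h h' hlt hlt'
    obtain ⟨q, hq, rfl⟩ := key v w h hlt
    obtain ⟨q', hq', rfl⟩ := key v w' h' hlt'
    rw [(hH.existsUnique_path r v).unique hq hq']

/-- Choosing representatives down a rooted tree: if every element of the set at the parent of `v`
is related to some element of the set at `v`, then representatives related along all tree edges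
can be chosen from the root downwards. -/
lemma exists_choice_along_tree {W α : Type*} (d : W → ℕ) (r : W) (p : W → W)
    (hp : ∀ v, v ≠ r → d (p v) < d v) (S : W → Set α) (hr : (S r).Nonempty) (E : α → α → Prop)
    (hE : ∀ v, v ≠ r → ∀ x ∈ S (p v), ∃ y ∈ S v, E y x) :
    ∃ f : W → α, (∀ v, f v ∈ S v) ∧ ∀ v, v ≠ r → E (f v) (f (p v)) := by
  classical
  have wf : WellFounded (fun v w : W => d v < d w) := (measure d).wf
  obtain ⟨x₀, hx₀⟩ := hr
  choose g hgS hgE using hE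
  let step : ∀ v : W, (∀ w, d w < d v → S w) → S v := fun v ih =>
    if h : v = r then ⟨x₀, h ▸ hx₀⟩
    else ⟨g v h (ih (p v) (hp v h)).1 (ih (p v) (hp v h)).2, hgS _ _ _ _⟩
  let F : ∀ v, S v := wf.fix step
  refine ⟨fun v => (F v).1, fun v => (F v).2, fun v hv => ?_⟩
  have h1 : F v = step v (fun w _ => F w) := wf.fix_eq step v
  have h2 : (F v).1 = g v hv (F (p v)).1 (F (p v)).2 := by
    rw [h1]; simp only [step, dif_neg hv]
  change E (F v).1 (F (p v)).1
  rw [h2]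
  exact hgE _ _ _ _

namespace Bigraph

/-- A rooting of a tree bigraph at a vertex `r` of the second part: depths `h₁`, `h₂` on the two
parts, and the parent `p u` of each vertex `u` of the first part. The other neighbours of `u` are
its children. -/
structure Rooting {W₁ W₂ : Type*} (T : Bigraph W₁ W₂) (r : W₂) where
  /-- depth on the first part -/
  h₁ : W₁ → ℕ
  /-- depth on the second part -/
  h₂ : W₂ → ℕ
  /-- the parent of a vertex of the first part -/
  p : W₁ → W₂
  adj_parent : ∀ u, T.Adj u (p u)
  parent_lt : ∀ u, h₂ (p u) < h₁ u
  lt_child : ∀ u w, T.Adj u w → w ≠ p u → h₁ u < h₂ w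
  parent_unique : ∀ w u u', T.Adj u w → T.Adj u' w → h₁ u < h₂ w → h₁ u' < h₂ w → u = u'
  root_eq_parent : ∀ u, T.Adj u r → r = p u
  exists_parent : ∀ w, w ≠ r → ∃ u, T.Adj u w ∧ w ≠ p u

lemma IsTree.nonempty_rooting {W₁ W₂ : Type*} {T : Bigraph W₁ W₂} (hT : T.IsTree) (r : W₂) :
    Nonempty (T.Rooting r) := by
  obtain ⟨d, hd0, hne, hex, huni⟩ := SimpleGraph.IsTree.exists_depth hT (Sum.inr r)
  have h1 : ∀ u : W₁, ∃ w : W₂, T.Adj u w ∧ d (Sum.inr w) < d (Sum.inl u) := by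
    intro u
    obtain ⟨w, hw, hlt⟩ := hex (Sum.inl u) (by simp)
    rcases w with w | w
    · exact hw.elim
    · exact ⟨w, hw, hlt⟩
  choose p hp hpd using h1
  have hch : ∀ u w, T.Adj u w → w ≠ p u → d (Sum.inl u) < d (Sum.inr w) := by
    intro u w h hw
    rcases lt_trichotomy (d (Sum.inl u)) (d (Sum.inr w)) with hlt | heq | hgt
    · exact hlt
    · exact absurd heq (hne (Sum.inl u) (Sum.inr w) h)
    · exact absurd (Sum.inr_injective (huni (Sum.inl u) (Sum.inr w) (Sum.inr (p u)) h (hp u)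
        hgt (hpd u))) hw
  refine ⟨⟨fun u => d (Sum.inl u), fun w => d (Sum.inr w), p, hp, hpd, hch, ?_, ?_, ?_⟩⟩
  · intro w u u' h h' hlt hlt'
    exact Sum.inl_injective (huni (Sum.inr w) (Sum.inl u) (Sum.inl u') h h' hlt hlt')
  · intro u hu
    by_contra hne
    have := hch u r hu hne
    omega
  · intro w hw
    obtain ⟨u, hu, hlt⟩ := hex (Sum.inr w) (by simpa using hw)
    rcases u with u | u
    · refine ⟨u, hu, ?_⟩
      rintro rfl
      exact absurd (hpd u) (not_lt.mpr hlt.le)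
    · exact hu.elim

/-- Selecting a copy of the tree from a family of sets, top-down from the root. -/
lemma Rooting.exists_selection {W₁ W₂ V₁ V₂ : Type*} {T : Bigraph W₁ W₂} {r : W₂}
    (R : T.Rooting r) (G : Bigraph V₁ V₂) (A : W₁ → Finset V₁) (L : W₂ → Finset V₂)
    (hr : (L r).Nonempty)
    (hchild : ∀ u w, T.Adj u w → w ≠ R.p u → ∀ y ∈ A u, ∃ x ∈ L w, G.Adj y x)
    (hparent : ∀ u, ∀ x ∈ L (R.p u), ∃ y ∈ A u, G.Adj y x) :
    ∃ (f₁ : W₁ → V₁) (f₂ : W₂ → V₂), (∀ u, f₁ u ∈ A u) ∧ (∀ w, f₂ w ∈ L w) ∧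
      ∀ u w, T.Adj u w → G.Adj (f₁ u) (f₂ w) := by
  classical
  choose q hq hqp using R.exists_parent
  let p' : W₁ ⊕ W₂ → W₁ ⊕ W₂ := Sum.elim (fun u => Sum.inr (R.p u))
    (fun w => if h : w = r then Sum.inr w else Sum.inl (q w h))
  let S : W₁ ⊕ W₂ → Set (V₁ ⊕ V₂) := Sum.elim (fun u => Sum.inl '' (A u : Set V₁))
    (fun w => Sum.inr '' (L w : Set V₂))
  obtain ⟨f, hfS, hfE⟩ := exists_choice_along_tree (Sum.elim R.h₁ R.h₂) (Sum.inr r) p'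
    (by
      rintro (u | w) hv
      · exact R.parent_lt u
      · have hw : w ≠ r := by simpa using hv
        simpa [p', hw] using R.lt_child _ _ (hq w hw) (hqp w hw)) S
    (by simpa [S] using hr) G.toSimpleGraph.Adj
    (by
      rintro (u | w) hv
      · rintro _ ⟨x, hx, rfl⟩
        obtain ⟨y, hy, hyx⟩ := hparent u x hx
        exact ⟨Sum.inl y, ⟨y, hy, rfl⟩, hyx⟩
      · have hw : w ≠ r := by simpa using hv
        have hp' : p' (Sum.inr w) = Sum.inl (q w hw) := by simp [p', hw]
        rw [hp']
        rintro _ ⟨y, hy, rfl⟩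
        obtain ⟨x, hx, hyx⟩ := hchild _ _ (hq w hw) (hqp w hw) y hy
        exact ⟨Sum.inr x, ⟨x, hx, rfl⟩, hyx⟩)
  have e1 : ∀ u, ∃ y ∈ A u, f (Sum.inl u) = Sum.inl y := fun u => by
    obtain ⟨y, hy, h⟩ := hfS (Sum.inl u); exact ⟨y, hy, h.symm⟩
  have e2 : ∀ w, ∃ x ∈ L w, f (Sum.inr w) = Sum.inr x := fun w => by
    obtain ⟨y, hy, h⟩ := hfS (Sum.inr w); exact ⟨y, hy, h.symm⟩
  choose f₁ hf₁ hf₁' using e1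
  choose f₂ hf₂ hf₂' using e2
  refine ⟨f₁, f₂, hf₁, hf₂, fun u w h => ?_⟩
  by_cases hw : w = R.p u
  · subst hw
    have := hfE (Sum.inl u) (by simp)
    rw [show p' (Sum.inl u) = Sum.inr (R.p u) from rfl, hf₁', hf₂'] at this
    exact this
  · have hr : w ≠ r := by
      rintro rfl
      exact hw (R.root_eq_parent u h)
    have hlt := R.lt_child u w h hw
    have hu : q w hr = u := R.parent_unique w _ _ (hq w hr) h
      (R.lt_child _ _ (hq w hr) (hqp w hr)) hlt
    have := hfE (Sum.inr w) (by simpa using hr)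
    rw [show p' (Sum.inr w) = Sum.inl (q w hr) by simp [p', hr], hu, hf₁', hf₂'] at this
    exact this

end Bigraph

/-! ### Neighbourhoods, greedy covering and resistant pairs -/

namespace Bigraph

variable {V₁ V₂ : Type*}

open scoped Classical in
/-- The neighbours in `A` of a vertex `x` of the second part. -/
noncomputable def nbrs₁ (G : Bigraph V₁ V₂) (A : Finset V₁) (x : V₂) : Finset V₁ :=
  {a ∈ A | G.Adj a x}

open scoped Classical in
/-- The neighbours in `X` of a vertex `y` of the first part. -/
noncomputable def nbrs₂ (G : Bigraph V₁ V₂) (X : Finset V₂) (y : V₁) : Finset V₂ :=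
  {x ∈ X | G.Adj y x}

open scoped Classical in
/-- The vertices of `X` that have a neighbour in `Y`. -/
noncomputable def covered (G : Bigraph V₁ V₂) (X : Finset V₂) (Y : Finset V₁) : Finset V₂ :=
  {x ∈ X | ∃ y ∈ Y, G.Adj y x}

@[simp] lemma mem_nbrs₁ {G : Bigraph V₁ V₂} {A : Finset V₁} {x : V₂} {a : V₁} :
    a ∈ G.nbrs₁ A x ↔ a ∈ A ∧ G.Adj a x := by simp [nbrs₁]

@[simp] lemma mem_nbrs₂ {G : Bigraph V₁ V₂} {X : Finset V₂} {y : V₁} {x : V₂} :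
    x ∈ G.nbrs₂ X y ↔ x ∈ X ∧ G.Adj y x := by simp [nbrs₂]

@[simp] lemma mem_covered {G : Bigraph V₁ V₂} {X : Finset V₂} {Y : Finset V₁} {x : V₂} :
    x ∈ G.covered X Y ↔ x ∈ X ∧ ∃ y ∈ Y, G.Adj y x := by simp [covered]

lemma nbrs₁_mono (G : Bigraph V₁ V₂) {A A' : Finset V₁} (h : A ⊆ A') (x : V₂) :
    G.nbrs₁ A x ⊆ G.nbrs₁ A' x := fun a ha => by
  rw [mem_nbrs₁] at ha ⊢; exact ⟨h ha.1, ha.2⟩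

lemma sum_card_nbrs (G : Bigraph V₁ V₂) (Y : Finset V₁) (X : Finset V₂) :
    ∑ y ∈ Y, (G.nbrs₂ X y).card = ∑ x ∈ X, (G.nbrs₁ Y x).card := by
  classical
  exact Finset.sum_card_bipartiteAbove_eq_sum_card_bipartiteBelow G.Adj

lemma card_covered_le (G : Bigraph V₁ V₂) (X : Finset V₂) (Y : Finset V₁) :
    (G.covered X Y).card ≤ ∑ y ∈ Y, (G.nbrs₂ X y).card := by
  classical
  refine le_trans (Finset.card_le_card (t := Y.biUnion (G.nbrs₂ X)) ?_) Finset.card_biUnion_le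
  intro x hx
  obtain ⟨hxX, y, hy, hyx⟩ := mem_covered.1 hx
  exact Finset.mem_biUnion.2 ⟨y, hy, mem_nbrs₂.2 ⟨hxX, hyx⟩⟩

/-- Greedy covering: if every vertex of `L` has at least `d` neighbours in `Y`, then `q` vertices
of `Y` cover half of `L`, or at least a `q d / (2 |Y|)` fraction of it. -/
lemma exists_cover (G : Bigraph V₁ V₂) (L : Finset V₂) (Y : Finset V₁) (d : ℝ) (hd0 : 0 ≤ d)
    (hd : ∀ x ∈ L, d ≤ (G.nbrs₁ Y x).card) (q : ℕ) :
    ∃ Y' ⊆ Y, Y'.card ≤ q ∧ ((L.card : ℝ) ≤ 2 * (G.covered L Y').card ∨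
      q * d * L.card ≤ 2 * Y.card * (G.covered L Y').card) := by
  classical
  induction q with
  | zero => exact ⟨∅, by simp, by simp, Or.inr (by simp; positivity)⟩
  | succ q ih =>
    obtain ⟨Y', hY', hq, h⟩ := ih
    by_cases hhalf : (L.card : ℝ) ≤ 2 * (G.covered L Y').card
    · exact ⟨Y', hY', by omega, Or.inl hhalf⟩
    have h := h.resolve_left hhalf
    push Not at hhalf
    have hcovL : G.covered L Y' ⊆ L := fun x hx => (mem_covered.1 hx).1
    set U := L \ G.covered L Y' with hU
    have hUcard : (U.card : ℝ) = L.card - (G.covered L Y').card := by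
      rw [hU, Finset.card_sdiff_of_subset hcovL, Nat.cast_sub (Finset.card_le_card hcovL)]
    have hsum : d * U.card ≤ ∑ y ∈ Y, ((G.nbrs₂ U y).card : ℝ) := by
      have h1 : ((∑ y ∈ Y, (G.nbrs₂ U y).card : ℕ) : ℝ) = ∑ x ∈ U, ((G.nbrs₁ Y x).card : ℝ) := by
        rw [sum_card_nbrs]; push_cast; rfl
      rw [← Nat.cast_sum, h1, mul_comm, ← nsmul_eq_mul]
      exact Finset.card_nsmul_le_sum _ _ _ fun x hx => hd x (Finset.mem_sdiff.1 hx).1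
    have hLpos : (0 : ℝ) < L.card := by
      have : (0 : ℝ) ≤ (G.covered L Y').card := by positivity
      linarith
    obtain ⟨x, hx⟩ : L.Nonempty := Finset.card_pos.1 (by exact_mod_cast hLpos)
    rcases Y.eq_empty_or_nonempty with rfl | hne
    · have h0 : d ≤ 0 := by simpa [nbrs₁] using hd x hx
      have : d = 0 := le_antisymm h0 hd0
      exact ⟨∅, by simp, by simp, Or.inr (by simp [this])⟩
    have hYpos : (0 : ℝ) < Y.card := by exact_mod_cast Finset.card_pos.2 hne
    obtain ⟨y, hy, hyd⟩ : ∃ y ∈ Y, d * U.card / Y.card ≤ (G.nbrs₂ U y).card := by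
      refine Finset.exists_le_of_sum_le hne ?_
      rw [Finset.sum_const, nsmul_eq_mul, mul_div_cancel₀ _ hYpos.ne']
      exact hsum
    refine ⟨insert y Y', Finset.insert_subset hy hY', (Finset.card_insert_le _ _).trans (by omega),
      Or.inr ?_⟩
    have hsub : (G.covered L Y') ∪ (G.nbrs₂ U y) ⊆ G.covered L (insert y Y') := by
      intro x hx
      rcases Finset.mem_union.1 hx with hx | hx
      · obtain ⟨hxL, y', hy', hadj⟩ := mem_covered.1 hx
        exact mem_covered.2 ⟨hxL, y', Finset.mem_insert_of_mem hy', hadj⟩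
      · obtain ⟨hxU, hadj⟩ := mem_nbrs₂.1 hx
        exact mem_covered.2 ⟨(Finset.mem_sdiff.1 hxU).1, y, Finset.mem_insert_self _ _, hadj⟩
    have hdisj : Disjoint (G.covered L Y') (G.nbrs₂ U y) := by
      rw [Finset.disjoint_left]
      intro x hx hx'
      exact (Finset.mem_sdiff.1 (mem_nbrs₂.1 hx').1).2 hx
    have hcard := Finset.card_le_card hsub
    rw [Finset.card_union_of_disjoint hdisj] at hcard
    have hcard' : ((G.covered L Y').card : ℝ) + (G.nbrs₂ U y).card ≤
        (G.covered L (insert y Y')).card := by exact_mod_cast hcard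
    rw [div_le_iff₀ hYpos] at hyd
    push_cast
    have h3 : d * L.card ≤ 2 * (d * U.card) := by
      rw [hUcard]; nlinarith
    nlinarith

/-- The pair `(A, X)`, whose degrees from `X` to `A` are measured against `D`, resists shrinking:
replacing `A` by a subset of at least a `1 / (8 K ^ 2)` fraction and `X` by a subset of at least a
`ν ^ e` fraction, for `1 ≤ e ≤ E`, cannot bring the maximum degree down to `ν ^ (M * e) * D`. -/
def Resists (G : Bigraph V₁ V₂) (A : Finset V₁) (X : Finset V₂) (D ν : ℝ) (K M E : ℕ) : Prop :=
  ∀ e, 1 ≤ e → e ≤ E → ∀ A' ⊆ A, ∀ X' ⊆ X, (A.card : ℝ) ≤ 8 * K ^ 2 * A'.card →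
    ν ^ e * X.card ≤ X'.card → ∃ x ∈ X', ν ^ (M * e) * D < (G.nbrs₁ A' x).card

set_option maxHeartbeats 800000 in
/-- One step of the construction. From a linear set `B` of candidates, a small set `Y'` is chosen
so that it covers a large part `Z'` of the set `L z` of the parent, each of its members has a
neighbour in every `L w` (in particular in the sets of the children), and it leaves at least half
of every `L w` uncovered. -/
lemma Resists.exists_step {G : Bigraph V₁ V₂} {A : Finset V₁} {X : Finset V₂} {D ν : ℝ}
    {K M E : ℕ} (hres : G.Resists A X D ν K M E) (hK : 1 ≤ K) (hD : 0 < D) (hν : 0 < ν)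
    (hνK : ν * (128 * K ^ 3) ≤ 1) (hdeg : ∀ x ∈ X, ((G.nbrs₁ A x).card : ℝ) ≤ D)
    (hDA : 16 * K ^ 3 * D ≤ A.card) (hX : X.Nonempty) {e : ℕ} (he : 1 ≤ e) (heE : e + 1 ≤ E)
    {ι : Type*} (I : Finset ι) (hI : I.card ≤ K) (L : ι → Finset V₂) (hLX : ∀ w ∈ I, L w ⊆ X)
    (hL : ∀ w ∈ I, ν ^ e * X.card ≤ (L w).card) (B : Finset V₁) (hBA : B ⊆ A)
    (hB : 3 * (A.card : ℝ) ≤ 8 * K * B.card) {z : ι} (hz : z ∈ I) :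
    ∃ Y' ⊆ B, ∃ Z' ⊆ L z, Y'.card * (16 * K ^ 3 * D) ≤ A.card ∧
      ν ^ ((M + 1) * (e + 1)) * X.card ≤ Z'.card ∧ (∀ x ∈ Z', ∃ y ∈ Y', G.Adj y x) ∧
      (∀ w ∈ I, ∀ y ∈ Y', ∃ x ∈ L w, G.Adj y x) ∧
      ∀ w ∈ I, ((L w).card : ℝ) ≤ 2 * ((L w).card - (G.covered (L w) Y').card) := by
  classical
  have hK1 : (1 : ℝ) ≤ K := by exact_mod_cast hK
  have hK3 : (1 : ℝ) ≤ (K : ℝ) ^ 3 := one_le_pow₀ hK1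
  have hν1 : ν ≤ 1 := by nlinarith
  have hν8 : 8 * ν ≤ 1 := by nlinarith
  have hXpos : (0 : ℝ) < X.card := by exact_mod_cast Finset.card_pos.2 hX
  have hApos : (0 : ℝ) < A.card := lt_of_lt_of_le (by positivity) hDA
  have hLpos : ∀ w ∈ I, (0 : ℝ) < (L w).card := fun w hw =>
    lt_of_lt_of_le (by positivity) (hL w hw)
  -- vertices without a neighbour in `L w`
  let N : ι → Finset V₁ := fun w => {y ∈ B | ¬ ∃ x ∈ L w, G.Adj y x}
  -- vertices with too many neighbours in `L w`
  let H : ι → Finset V₁ := fun w => {y ∈ B | 8 * K ^ 2 * D * (L w).card < A.card *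
    ((G.nbrs₂ (L w) y).card : ℝ)}
  have hN : ∀ w ∈ I, 8 * K ^ 2 * ((N w).card : ℝ) ≤ A.card := by
    intro w hw
    by_contra hcon
    push Not at hcon
    obtain ⟨x, hx, hlt⟩ := hres e he (by omega) (N w)
      ((Finset.filter_subset _ _).trans hBA) (L w) (hLX w hw) hcon.le (hL w hw)
    have : (0 : ℝ) < (G.nbrs₁ (N w) x).card := lt_of_le_of_lt (by positivity) hlt
    obtain ⟨y, hy⟩ := Finset.card_pos.1 (by exact_mod_cast this)
    obtain ⟨hyN, hyx⟩ := mem_nbrs₁.1 hy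
    exact (Finset.mem_filter.1 hyN).2 ⟨x, hx, hyx⟩
  have hH : ∀ w ∈ I, 8 * K ^ 2 * ((H w).card : ℝ) ≤ A.card := by
    intro w hw
    have h1 : ∑ y ∈ H w, (A.card * ((G.nbrs₂ (L w) y).card : ℝ)) ≤ A.card * (D * (L w).card) := by
      rw [← Finset.mul_sum, ← Nat.cast_sum, sum_card_nbrs, Nat.cast_sum]
      refine mul_le_mul_of_nonneg_left ?_ hApos.le
      rw [mul_comm, ← nsmul_eq_mul]
      refine Finset.sum_le_card_nsmul _ _ _ fun x hx => le_trans ?_ (hdeg x (hLX w hw hx))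
      exact_mod_cast Finset.card_le_card
        (G.nbrs₁_mono ((Finset.filter_subset _ _).trans hBA) x)
    have h2 : (H w).card * (8 * K ^ 2 * D * (L w).card) ≤
        ∑ y ∈ H w, (A.card * ((G.nbrs₂ (L w) y).card : ℝ)) := by
      rw [← nsmul_eq_mul]
      exact Finset.card_nsmul_le_sum _ _ _ fun y hy => (Finset.mem_filter.1 hy).2.le
    have h3 : 0 < D * (L w).card := mul_pos hD (hLpos w hw)
    refine le_of_mul_le_mul_right ?_ h3
    linarith [h1, h2]
  -- `N w` is small because `(N w, L w)` would otherwise be an edgeless pair, against resistance;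
  -- `H w` is small by counting the edges between `A` and `L w`
  let Y := B \ I.biUnion fun w => N w ∪ H w
  have hYB : Y ⊆ B := Finset.sdiff_subset
  have hYA : (Y.card : ℝ) ≤ A.card := by exact_mod_cast Finset.card_le_card (hYB.trans hBA)
  have hYbig : (A.card : ℝ) ≤ 8 * K * Y.card := by
    have h1 : ((I.biUnion fun w => N w ∪ H w).card : ℝ) ≤
        ∑ w ∈ I, ((N w).card + (H w).card : ℝ) := by
      have := (Finset.card_biUnion_le (s := I) (t := fun w => N w ∪ H w)).trans
        (Finset.sum_le_sum fun w _ => Finset.card_union_le (N w) (H w))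
      exact_mod_cast this
    have h2 : 8 * K ^ 2 * ∑ w ∈ I, ((N w).card + (H w).card : ℝ) ≤ K * (2 * A.card) := by
      rw [Finset.mul_sum]
      calc ∑ w ∈ I, 8 * (K : ℝ) ^ 2 * ((N w).card + (H w).card : ℝ)
          ≤ ∑ w ∈ I, (2 * A.card : ℝ) :=
            Finset.sum_le_sum fun w hw => by linarith [hN w hw, hH w hw]
        _ = I.card * (2 * A.card) := by rw [Finset.sum_const, nsmul_eq_mul]
        _ ≤ K * (2 * A.card) := by
            have : (I.card : ℝ) ≤ K := by exact_mod_cast hI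
            gcongr
    have h3 : (B.card : ℝ) ≤ Y.card + (I.biUnion fun w => N w ∪ H w).card := by
      have := Finset.le_card_sdiff (I.biUnion fun w => N w ∪ H w) B
      have : B.card ≤ Y.card + (I.biUnion fun w => N w ∪ H w).card := by
        change _ ≤ (B \ _).card + _
        omega
      exact_mod_cast this
    have hKpos : (0 : ℝ) < K := by linarith
    have h4 : 8 * K * ∑ w ∈ I, ((N w).card + (H w).card : ℝ) ≤ 2 * A.card := by
      refine le_of_mul_le_mul_left ?_ hKpos
      linarith [h2]
    have h5 := mul_le_mul_of_nonneg_left (h3.trans (add_le_add_right h1 _))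
      (by positivity : (0 : ℝ) ≤ 8 * K)
    linarith
  have hYτ : (A.card : ℝ) ≤ 8 * K ^ 2 * Y.card := by
    refine hYbig.trans ?_
    have : (K : ℝ) ≤ K ^ 2 := by nlinarith
    gcongr
  -- by resistance, at least half of `L z` has the degree `d` into `Y`
  set d := ν ^ (M * (e + 1)) * D with hd
  have hdpos : 0 < d := by positivity
  let Lg : Finset V₂ := {x ∈ L z | d ≤ (G.nbrs₁ Y x).card}
  have hLg : ((L z).card : ℝ) ≤ 2 * Lg.card := by
    have h1 : Lg.card + ({x ∈ L z | ¬ d ≤ (G.nbrs₁ Y x).card} : Finset V₂).card = (L z).card :=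
      Finset.card_filter_add_card_filter_not _
    have h1' : (Lg.card : ℝ) + ({x ∈ L z | ¬ d ≤ (G.nbrs₁ Y x).card} : Finset V₂).card =
      (L z).card := by exact_mod_cast h1
    have h2 : (({x ∈ L z | ¬ d ≤ (G.nbrs₁ Y x).card} : Finset V₂).card : ℝ) <
        ν ^ (e + 1) * X.card := by
      by_contra hcon
      push Not at hcon
      obtain ⟨x, hx, hlt⟩ := hres (e + 1) (by omega) heE Y (hYB.trans hBA) _
        ((Finset.filter_subset _ _).trans (hLX z hz)) hYτ hcon
      exact absurd hlt.le (by simpa using (Finset.mem_filter.1 hx).2)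
    have h3 := hL z hz
    have h4 : ν ^ (e + 1) * X.card ≤ ν * (L z).card := by
      rw [pow_succ]; nlinarith
    have h5 : ν * (L z).card ≤ 1 / 8 * (L z).card := by
      have := hLpos z hz
      gcongr; linarith
    linarith [hLpos z hz]
  set q := ⌊A.card / (16 * K ^ 3 * D)⌋₊ with hq
  have h16 : 0 < 16 * (K : ℝ) ^ 3 * D := by positivity
  have hqle : q * (16 * K ^ 3 * D) ≤ A.card := by
    rw [← le_div_iff₀ h16]
    exact Nat.floor_le (by positivity)
  have hqge : (A.card : ℝ) ≤ q * (32 * K ^ 3 * D) := by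
    have h1 : 1 ≤ q := Nat.le_floor (by rw [Nat.cast_one, le_div_iff₀ h16]; linarith)
    have h1' : (1 : ℝ) ≤ q := by exact_mod_cast h1
    have h2 : A.card / (16 * K ^ 3 * D) < (q : ℝ) + 1 := Nat.lt_floor_add_one _
    rw [div_lt_iff₀ h16] at h2
    nlinarith
  obtain ⟨Y', hY'Y, hY'q, hcov⟩ := G.exists_cover Lg Y d hdpos.le
    (fun x hx => (Finset.mem_filter.1 hx).2) q
  have hY'q' : (Y'.card : ℝ) ≤ q := by exact_mod_cast hY'q
  have hY'A : Y'.card * (16 * K ^ 3 * D) ≤ (A.card : ℝ) :=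
    le_trans (by gcongr) hqle
  refine ⟨Y', hY'Y.trans hYB, G.covered Lg Y', ?_, hY'A, ?_, ?_, ?_, ?_⟩
  · intro x hx
    exact (Finset.mem_filter.1 (mem_covered.1 hx).1).1
  · have hsplit : ν ^ ((M + 1) * (e + 1)) * X.card = ν ^ (M * (e + 1)) * ν * (ν ^ e * X.card) := by
      ring
    have hm1 : ν ^ (M * (e + 1)) ≤ 1 := pow_le_one₀ hν.le hν1
    have hm0 : 0 < ν ^ (M * (e + 1)) := by positivity
    have hLz := hLpos z hz
    rw [hsplit]
    refine (mul_le_mul_of_nonneg_left (hL z hz) (by positivity)).trans ?_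
    rcases hcov with hcov | hcov
    · calc ν ^ (M * (e + 1)) * ν * (L z).card ≤ 1 * (1 / 8) * (L z).card := by
            gcongr; linarith
        _ ≤ _ := by linarith
    · have hZ0 : (0 : ℝ) ≤ (G.covered Lg Y').card := by positivity
      have h1 : q * d * (L z).card ≤ 4 * A.card * (G.covered Lg Y').card := by
        have h2 : q * d * (L z).card ≤ q * d * (2 * Lg.card) := by gcongr
        have h3 : 2 * Y.card * ((G.covered Lg Y').card : ℝ) ≤
          2 * A.card * (G.covered Lg Y').card := by gcongr
        linarith
      have h4 : A.card * (ν ^ (M * (e + 1)) * (L z).card) ≤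
          32 * K ^ 3 * (q * d * (L z).card) := by
        have := mul_le_mul_of_nonneg_right hqge
          (by positivity : 0 ≤ ν ^ (M * (e + 1)) * ((L z).card : ℝ))
        rw [hd]; linarith
      have h5 : A.card * (ν ^ (M * (e + 1)) * (L z).card) ≤
          A.card * (128 * K ^ 3 * (G.covered Lg Y').card) := by
        refine h4.trans ((mul_le_mul_of_nonneg_left h1 (by positivity)).trans_eq (by ring))
      have h6 := le_of_mul_le_mul_left h5 hApos
      calc ν ^ (M * (e + 1)) * ν * (L z).card = ν * (ν ^ (M * (e + 1)) * (L z).card) := by ring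
        _ ≤ ν * (128 * K ^ 3 * (G.covered Lg Y').card) := by gcongr
        _ = ν * (128 * K ^ 3) * (G.covered Lg Y').card := by ring
        _ ≤ 1 * (G.covered Lg Y').card := by gcongr
        _ = _ := one_mul _
  · intro x hx
    exact (mem_covered.1 hx).2
  · intro w hw y hy
    have hyY := hY'Y hy
    by_contra hcon
    exact (Finset.mem_sdiff.1 hyY).2 (Finset.mem_biUnion.2 ⟨w, hw, Finset.mem_union_left _
      (Finset.mem_filter.2 ⟨hYB hyY, hcon⟩)⟩)
  · intro w hw
    have hlow : ∀ y ∈ Y', A.card * ((G.nbrs₂ (L w) y).card : ℝ) ≤ 8 * K ^ 2 * D * (L w).card := by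
      intro y hy
      have hyY := hY'Y hy
      by_contra hcon
      exact (Finset.mem_sdiff.1 hyY).2 (Finset.mem_biUnion.2 ⟨w, hw, Finset.mem_union_right _
        (Finset.mem_filter.2 ⟨hYB hyY, not_le.1 hcon⟩)⟩)
    have h1 : ((G.covered (L w) Y').card : ℝ) ≤ ∑ y ∈ Y', ((G.nbrs₂ (L w) y).card : ℝ) := by
      exact_mod_cast G.card_covered_le (L w) Y'
    have h2 : A.card * ∑ y ∈ Y', ((G.nbrs₂ (L w) y).card : ℝ) ≤
        Y'.card * (8 * K ^ 2 * D * (L w).card) := by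
      rw [Finset.mul_sum, ← nsmul_eq_mul]
      exact Finset.sum_le_card_nsmul _ _ _ hlow
    have h3 : 2 * (Y'.card * (8 * K ^ 2 * D)) ≤ A.card := by
      refine le_trans ?_ hY'A
      have : (K : ℝ) ^ 2 ≤ K ^ 3 := pow_le_pow_right₀ hK1 (by norm_num)
      have h0 : 0 ≤ Y'.card * D := by positivity
      nlinarith
    have h4 : A.card * (2 * ((G.covered (L w) Y').card : ℝ)) ≤ A.card * (L w).card := by
      have := mul_le_mul_of_nonneg_left h1 hApos.le
      have h5 := mul_le_mul_of_nonneg_right h3 (hLpos w hw).le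
      linarith
    have := le_of_mul_le_mul_left h4 hApos
    linarith

end Bigraph

/-! ### Building the tree in a resistant pair -/

namespace Bigraph

/-- The exponents (to the base `ν`) that bound the sizes of the sets of the second part after `t`
steps of the construction. -/
def scale (M : ℕ) : ℕ → ℕ
  | 0 => 1
  | t + 1 => (M + 1) * (scale M t + 1)

lemma scale_succ (M t : ℕ) : scale M (t + 1) = (M + 1) * (scale M t + 1) := rfl

lemma scale_add_one_le (M t : ℕ) : scale M t + 1 ≤ scale M (t + 1) :=
  Nat.le_mul_of_pos_left _ M.succ_pos

lemma scale_mono (M : ℕ) : Monotone (scale M) :=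
  monotone_nat_of_le_succ fun t => (Nat.le_succ _).trans (scale_add_one_le M t)

lemma one_le_scale (M t : ℕ) : 1 ≤ scale M t := scale_mono M (Nat.zero_le t)

section Construction

variable {W₁ W₂ V₁ V₂ : Type*} {T : Bigraph W₁ W₂} {r : W₂}

/-- A vertex `w` of the second part is live, when the vertices in `P` have been processed, if its
parent is not in `P`. -/
def Rooting.Live (R : T.Rooting r) (P : Finset W₁) (w : W₂) : Prop :=
  ∀ u ∈ P, T.Adj u w → w = R.p u

/-- The situation after the vertices `P` of the first part of the tree have been processed: each
vertex of the tree has a set of candidates, inside given initial sets `S₀`, `L₀`. Sets of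
unprocessed and of live vertices are large. Around a processed vertex `u`, the sets of
nonneighbours are anticomplete to the set of `u`, every candidate for the parent of `u` has a
neighbour among the candidates for `u`, and these have neighbours among the candidates for the
children of `u`. -/
structure Rooting.State (R : T.Rooting r) (G : Bigraph V₁ V₂) (S₀ : W₁ → Finset V₁)
    (L₀ : W₂ → Finset V₂) (a x : ℕ) (ν : ℝ) (K M : ℕ) (P : Finset W₁) (S : W₁ → Finset V₁)
    (L : W₂ → Finset V₂) : Prop where
  sub₁ : ∀ u, S u ⊆ S₀ u
  sub₂ : ∀ w, L w ⊆ L₀ w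
  card₁ : ∀ u, u ∉ P → (8 * K - P.card : ℝ) * a ≤ 16 * K ^ 2 * (S u).card
  card₂ : ∀ w, R.Live P w → ν ^ scale M P.card * x ≤ (L w).card
  anti : ∀ u ∈ P, ∀ w, ¬ T.Adj u w → G.IsAnticomplete (S u) (L w)
  child : ∀ u ∈ P, ∀ w, T.Adj u w → w ≠ R.p u → ∀ y ∈ S u, ∃ x ∈ L w, G.Adj y x
  parent : ∀ u ∈ P, ∀ x ∈ L (R.p u), ∃ y ∈ S u, G.Adj y x
  anti_of_not_live : ∀ u, u ∉ P → ∀ w, ¬ R.Live P w → G.IsAnticomplete (S u) (L w)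

set_option maxHeartbeats 800000 in
/-- Processing one more vertex `u`, all of whose descendants are processed. The set of `u` becomes
a small set whose neighbourhoods can be removed from the sets of all nonneighbours of `u`, and the
set of a child of `u` is cut down to one neighbour for each candidate for `u`, so that its
neighbourhood can be removed from the sets of all unprocessed vertices. -/
lemma Rooting.State.exists_insert [DecidableEq W₁] [Fintype W₂] {R : T.Rooting r}
    {G : Bigraph V₁ V₂}
    {S₀ : W₁ → Finset V₁} {L₀ : W₂ → Finset V₂} {A : Finset V₁} {X : Finset V₂} {D ν : ℝ}
    {K M E : ℕ} (hres : G.Resists A X D ν K M E) (hK : 1 ≤ K) (hD : 0 < D) (hν : 0 < ν)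
    (hνK : ν * (128 * K ^ 3) ≤ 1) (hdeg : ∀ x ∈ X, ((G.nbrs₁ A x).card : ℝ) ≤ D)
    (hDA : 16 * K ^ 3 * D ≤ A.card) (hX : X.Nonempty) (hW₂ : Fintype.card W₂ ≤ K)
    (hS₀ : ∀ u, S₀ u ⊆ A) (hL₀ : ∀ w, L₀ w ⊆ X)
    {P : Finset W₁} {S : W₁ → Finset V₁} {L : W₂ → Finset V₂}
    (h : R.State G S₀ L₀ A.card X.card ν K M P S L) (hPK : P.card ≤ K)
    (hE : scale M (P.card + 1) ≤ E) {u : W₁} (hu : u ∉ P)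
    (hP : ∀ u' ∈ P, R.h₁ u ≤ R.h₁ u') :
    ∃ S' L', R.State G S₀ L₀ A.card X.card ν K M (insert u P) S' L' := by
  classical
  have hK1 : (1 : ℝ) ≤ K := by exact_mod_cast hK
  have hPK' : (P.card : ℝ) ≤ K := by exact_mod_cast hPK
  have hXpos : (0 : ℝ) < X.card := by exact_mod_cast Finset.card_pos.2 hX
  have hApos : (0 : ℝ) < A.card := lt_of_lt_of_le (by positivity) hDA
  -- the parent of `u` is live, as its own parent is closer to the root than every member of `P`
  have hzlive : R.Live P (R.p u) := by
    intro u' hu' hadj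
    by_contra hne
    have h1 := R.lt_child u' _ hadj hne
    have h2 := R.parent_lt u
    have h3 := hP u' hu'
    omega
  have hclive : ∀ w, T.Adj u w → w ≠ R.p u → R.Live P w := by
    intro w hw hne u' hu' hadj
    by_contra hne'
    have := R.parent_unique w u u' hw hadj (R.lt_child _ _ hw hne) (R.lt_child _ _ hadj hne')
    exact hu (this ▸ hu')
  obtain ⟨Y', hY'S, Z', hZ'L, hY'card, hZ'card, hZ'cov, hY'nbr, hhalf⟩ :=
    hres.exists_step hK hD hν hνK hdeg hDA hX (one_le_scale M P.card)
      ((scale_add_one_le _ _).trans hE) (Finset.univ.filter (R.Live P))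
      ((Finset.card_le_univ _).trans hW₂) L (fun w _ => (h.sub₂ w).trans (hL₀ w))
      (fun w hw => h.card₂ w (Finset.mem_filter.1 hw).2) (S u) ((h.sub₁ u).trans (hS₀ u))
      (by
        have h1 := h.card₁ u hu
        have h2 : (7 * K : ℝ) * A.card ≤ (8 * K - P.card) * A.card := by gcongr; linarith
        have h3 : (K : ℝ) * (7 * A.card) ≤ K * (16 * K * (S u).card) := by linarith
        have h4 := le_of_mul_le_mul_left h3 (by linarith)
        linarith)
      (z := R.p u) (Finset.mem_filter.2 ⟨Finset.mem_univ _, hzlive⟩)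
  -- `C w` is the set kept for a child `w` of `u`: one neighbour for each element of `Y'`
  have hC : ∀ w, ∃ C ⊆ L w, C.card ≤ Y'.card ∧
      (R.Live P w → ∀ y ∈ Y', ∃ x ∈ C, G.Adj y x) := by
    intro w
    by_cases hw : R.Live P w
    · have : Nonempty V₂ := ⟨hX.choose⟩
      choose! g hg using hY'nbr w (Finset.mem_filter.2 ⟨Finset.mem_univ _, hw⟩)
      refine ⟨Y'.image g, ?_, Finset.card_image_le, fun _ y hy =>
        ⟨g y, Finset.mem_image_of_mem g hy, (hg y hy).2⟩⟩
      intro x hx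
      obtain ⟨y, hy, rfl⟩ := Finset.mem_image.1 hx
      exact (hg y hy).1
    · exact ⟨∅, by simp, by simp, fun h => absurd h hw⟩
  choose C hCL hCcard hCnbr using hC
  -- the part of `A` to be removed from the sets of the unprocessed vertices
  let Q : Finset V₁ := Finset.univ.biUnion fun w => (C w).biUnion fun x => G.nbrs₁ A x
  have hQ : 16 * K ^ 2 * (Q.card : ℝ) ≤ A.card := by
    have h1 : (Q.card : ℝ) ≤ ∑ w : W₂, ∑ x ∈ C w, ((G.nbrs₁ A x).card : ℝ) := by
      have := (Finset.card_biUnion_le (s := Finset.univ)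
        (t := fun w => (C w).biUnion fun x => G.nbrs₁ A x)).trans
        (Finset.sum_le_sum fun w _ => Finset.card_biUnion_le)
      exact_mod_cast this
    have h2 : ∀ w, ∑ x ∈ C w, ((G.nbrs₁ A x).card : ℝ) ≤ Y'.card * D := by
      intro w
      refine (Finset.sum_le_card_nsmul _ _ D fun x hx =>
        hdeg x (hL₀ w (h.sub₂ w (hCL w hx)))).trans ?_
      rw [nsmul_eq_mul]
      have : ((C w).card : ℝ) ≤ Y'.card := by exact_mod_cast hCcard w
      gcongr
    have h3 : (Q.card : ℝ) ≤ K * (Y'.card * D) := by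
      refine h1.trans ((Finset.sum_le_sum fun w _ => h2 w).trans ?_)
      rw [Finset.sum_const, nsmul_eq_mul, Finset.card_univ]
      have : (Fintype.card W₂ : ℝ) ≤ K := by exact_mod_cast hW₂
      gcongr
    calc 16 * K ^ 2 * (Q.card : ℝ) ≤ 16 * K ^ 2 * (K * (Y'.card * D)) := by gcongr
      _ = Y'.card * (16 * K ^ 3 * D) := by ring
      _ ≤ _ := hY'card
  let S' : W₁ → Finset V₁ := fun u' => if u' = u then Y' else if u' ∈ P then S u' else S u' \ Q
  let L' : W₂ → Finset V₂ := fun w => if ¬ R.Live P w then L w else if w = R.p u then Z' else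
    if T.Adj u w then C w else L w \ G.covered (L w) Y'
  have hS'u : S' u = Y' := by simp [S']
  have hne : ∀ u' ∈ P, u' ≠ u := fun u' hu' he => hu (he ▸ hu')
  have hS'P : ∀ u' ∈ P, S' u' = S u' := fun u' hu' => by simp [S', hne u' hu', hu']
  have hS'n : ∀ u', u' ∉ insert u P → S' u' = S u' \ Q := fun u' hu' => by
    rw [Finset.mem_insert, not_or] at hu'
    simp [S', hu'.1, hu'.2]
  have hS'sub : ∀ u', S' u' ⊆ S u' := by
    intro u'
    simp only [S']
    split_ifs with h1 h2
    · exact h1 ▸ hY'S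
    · exact subset_rfl
    · exact Finset.sdiff_subset
  have hL'n : ∀ w, ¬ R.Live P w → L' w = L w := fun w hw => by simp [L', hw]
  have hL'p : L' (R.p u) = Z' := by simp [L', hzlive]
  have hL'c : ∀ w, T.Adj u w → w ≠ R.p u → L' w = C w := fun w hw hwne => by
    simp [L', hclive w hw hwne, hwne, hw]
  have hL'o : ∀ w, R.Live P w → ¬ T.Adj u w → L' w = L w \ G.covered (L w) Y' :=
    fun w hw hadj => by
      have : w ≠ R.p u := fun he => hadj (he ▸ R.adj_parent u)
      simp [L', hw, this, hadj]
  have hL'sub : ∀ w, L' w ⊆ L w := by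
    intro w
    simp only [L']
    split_ifs with h1 h2 h3
    · exact h2 ▸ hZ'L
    · exact hCL w
    · exact Finset.sdiff_subset
    · exact subset_rfl
  have hPcard : (insert u P).card = P.card + 1 := Finset.card_insert_of_notMem hu
  refine ⟨S', L', ⟨fun u' => (hS'sub u').trans (h.sub₁ u'), fun w => (hL'sub w).trans (h.sub₂ w),
    ?_, ?_, ?_, ?_, ?_, ?_⟩⟩
  · intro u' hu'
    have hu'P : u' ∉ P := fun hc => hu' (Finset.mem_insert_of_mem hc)
    rw [hS'n u' hu', hPcard]
    have h1 : ((S u').card : ℝ) ≤ (S u' \ Q).card + Q.card := by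
      have := Finset.le_card_sdiff Q (S u')
      have : (S u').card ≤ (S u' \ Q).card + Q.card := by omega
      exact_mod_cast this
    have h2 := h.card₁ u' hu'P
    have h3 := mul_le_mul_of_nonneg_left h1 (by positivity : (0 : ℝ) ≤ 16 * K ^ 2)
    push_cast
    linarith
  · intro w hw
    have hwP : R.Live P w := fun u' hu' => hw u' (Finset.mem_insert_of_mem hu')
    have hwu := hw u (Finset.mem_insert_self _ _)
    rw [hPcard]
    by_cases hwp : w = R.p u
    · rw [hwp, hL'p]
      exact hZ'card
    · have hadj : ¬ T.Adj u w := fun hc => hwp (hwu hc)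
      rw [hL'o w hwP hadj]
      have h1 := hhalf w (Finset.mem_filter.2 ⟨Finset.mem_univ _, hwP⟩)
      have h2 : ((L w).card : ℝ) ≤ (L w \ G.covered (L w) Y').card + (G.covered (L w) Y').card := by
        have := Finset.le_card_sdiff (G.covered (L w) Y') (L w)
        have : (L w).card ≤ (L w \ G.covered (L w) Y').card + (G.covered (L w) Y').card := by omega
        exact_mod_cast this
      have h3 := h.card₂ w hwP
      have hK3 : (1 : ℝ) ≤ (K : ℝ) ^ 3 := one_le_pow₀ hK1
      have hν2 : 2 * ν ≤ 1 := by nlinarith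
      have h4 : ν ^ scale M (P.card + 1) ≤ ν * ν ^ scale M P.card := by
        rw [← pow_succ']
        exact pow_le_pow_of_le_one hν.le (by linarith) (scale_add_one_le _ _)
      have h5 : ν ^ scale M (P.card + 1) * X.card ≤ ν * (ν ^ scale M P.card * X.card) := by
        rw [← mul_assoc]; gcongr
      have h6 : 2 * ν * (ν ^ scale M P.card * X.card) ≤ 1 * (ν ^ scale M P.card * X.card) := by
        gcongr
      linarith
  · intro u' hu' w hadj y hy x hx
    rcases Finset.mem_insert.1 hu' with rfl | hu'
    · rw [hS'u] at hy
      by_cases hw : R.Live P w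
      · rw [hL'o w hw hadj] at hx
        intro hyx
        obtain ⟨hxL, hxn⟩ := Finset.mem_sdiff.1 hx
        exact hxn (mem_covered.2 ⟨hxL, y, hy, hyx⟩)
      · exact h.anti_of_not_live u' hu w hw y (hY'S hy) x (hL'sub w hx)
    · exact h.anti u' hu' w hadj y (hS'sub u' hy) x (hL'sub w hx)
  · intro u' hu' w hadj hwne y hy
    rcases Finset.mem_insert.1 hu' with rfl | hu'
    · rw [hS'u] at hy
      rw [hL'c w hadj hwne]
      exact hCnbr w (hclive w hadj hwne) y hy
    · rw [hL'n w fun hl => hwne (hl u' hu' hadj)]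
      exact h.child u' hu' w hadj hwne y (hS'sub u' hy)
  · intro u' hu' x hx
    rcases Finset.mem_insert.1 hu' with rfl | hu'
    · rw [hS'u]
      exact hZ'cov x (hL'p ▸ hx)
    · rw [hS'P u' hu']
      exact h.parent u' hu' x (hL'sub _ hx)
  · intro u' hu' w hw y hy x hx
    have hu'P : u' ∉ P := fun hc => hu' (Finset.mem_insert_of_mem hc)
    by_cases hwP : R.Live P w
    · have hadj : T.Adj u w ∧ w ≠ R.p u := by
        by_contra hcon
        refine hw fun u'' hu'' hadj => ?_
        rcases Finset.mem_insert.1 hu'' with rfl | hu''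
        · by_contra hne'
          exact hcon ⟨hadj, hne'⟩
        · exact hwP u'' hu'' hadj
      rw [hL'c w hadj.1 hadj.2] at hx
      rw [hS'n u' hu'] at hy
      obtain ⟨hyS, hyQ⟩ := Finset.mem_sdiff.1 hy
      intro hyx
      exact hyQ (Finset.mem_biUnion.2 ⟨w, Finset.mem_univ _, Finset.mem_biUnion.2 ⟨x, hx,
        mem_nbrs₁.2 ⟨hS₀ u' (h.sub₁ u' hyS), hyx⟩⟩⟩)
    · exact h.anti_of_not_live u' hu'P w hwP y (hS'sub u' hy) x (hL'sub w hx)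

/-- A resistant pair contains the tree, with the vertices of the copy in prescribed sets, provided
these make up a constant fraction of the pair. -/
lemma Rooting.exists_copy [Fintype W₁] [Fintype W₂] (R : T.Rooting r) {G : Bigraph V₁ V₂}
    {S₀ : W₁ → Finset V₁} {L₀ : W₂ → Finset V₂} {A : Finset V₁} {X : Finset V₂} {D ν : ℝ}
    {K M E : ℕ} (hres : G.Resists A X D ν K M E) (hK : 1 ≤ K) (hD : 0 < D) (hν : 0 < ν)
    (hνK : ν * (128 * K ^ 3) ≤ 1) (hdeg : ∀ x ∈ X, ((G.nbrs₁ A x).card : ℝ) ≤ D)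
    (hDA : 16 * K ^ 3 * D ≤ A.card) (hX : X.Nonempty) (hW₁ : Fintype.card W₁ ≤ K)
    (hW₂ : Fintype.card W₂ ≤ K) (hE : scale M K ≤ E)
    (hS₀ : ∀ u, S₀ u ⊆ A) (hL₀ : ∀ w, L₀ w ⊆ X)
    (hS₀card : ∀ u, A.card ≤ 2 * K * (S₀ u).card) (hL₀card : ∀ w, X.card ≤ 2 * K * (L₀ w).card) :
    ∃ (f₁ : W₁ → V₁) (f₂ : W₂ → V₂), (∀ u, f₁ u ∈ S₀ u) ∧ (∀ w, f₂ w ∈ L₀ w) ∧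
      ∀ u w, G.Adj (f₁ u) (f₂ w) ↔ T.Adj u w := by
  classical
  have hK1 : (1 : ℝ) ≤ K := by exact_mod_cast hK
  have hK0 : (0 : ℝ) < K := by linarith
  have hXpos : (0 : ℝ) < X.card := by exact_mod_cast Finset.card_pos.2 hX
  have hstate : ∀ t ≤ Fintype.card W₁, ∃ P : Finset W₁, P.card = t ∧
      (∀ u ∈ P, ∀ u', R.h₁ u < R.h₁ u' → u' ∈ P) ∧
      ∃ S L, R.State G S₀ L₀ A.card X.card ν K M P S L := by
    intro t
    induction t with
    | zero =>
      intro _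
      refine ⟨∅, rfl, by simp, S₀, L₀, ⟨fun _ => subset_rfl, fun _ => subset_rfl, ?_, ?_,
        by simp, by simp, by simp, ?_⟩⟩
      · intro u _
        have h1 : (A.card : ℝ) ≤ 2 * K * (S₀ u).card := by exact_mod_cast hS₀card u
        have h2 := mul_le_mul_of_nonneg_left h1 (by positivity : (0 : ℝ) ≤ 8 * K)
        simp only [Finset.card_empty, Nat.cast_zero, sub_zero]
        linarith
      · intro w _
        have h1 : (X.card : ℝ) ≤ 2 * K * (L₀ w).card := by exact_mod_cast hL₀card w
        have hK3 : (K : ℝ) ≤ K ^ 3 := le_self_pow₀ hK1 (by norm_num)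
        have h2 : ν * (2 * K) ≤ 1 := by nlinarith
        calc ν ^ scale M (∅ : Finset W₁).card * X.card = ν * X.card := by
              rw [Finset.card_empty, scale, pow_one]
          _ ≤ ν * (2 * K * (L₀ w).card) := by gcongr
          _ = ν * (2 * K) * (L₀ w).card := by ring
          _ ≤ 1 * (L₀ w).card := by gcongr
          _ = _ := one_mul _
      · intro u _ w hw
        exact absurd (fun u hu => by simp at hu) hw
    | succ t ih =>
      intro ht
      obtain ⟨P, hPt, hPup, S, L, hstate⟩ := ih (by omega)
      have hne : (Finset.univ \ P).Nonempty := by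
        rw [← Finset.card_pos, Finset.card_sdiff_of_subset (Finset.subset_univ P),
          Finset.card_univ]
        omega
      obtain ⟨u, hu, hmax⟩ := Finset.exists_max_image (Finset.univ \ P) R.h₁ hne
      have huP : u ∉ P := (Finset.mem_sdiff.1 hu).2
      have hup : ∀ u', R.h₁ u < R.h₁ u' → u' ∈ P := by
        intro u' hlt
        by_contra hcon
        have := hmax u' (Finset.mem_sdiff.2 ⟨Finset.mem_univ _, hcon⟩)
        omega
      obtain ⟨S', L', h'⟩ := hstate.exists_insert hres hK hD hν hνK hdeg hDA hX hW₂ hS₀ hL₀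
        (by omega) ((scale_mono M (by omega)).trans hE) huP (fun u' hu' => by
          by_contra hcon
          exact huP (hPup u' hu' u (not_le.1 hcon)))
      refine ⟨insert u P, by rw [Finset.card_insert_of_notMem huP, hPt], ?_, S', L', h'⟩
      intro u₁ hu₁ u₂ hlt
      rcases Finset.mem_insert.1 hu₁ with rfl | hu₁
      · exact Finset.mem_insert_of_mem (hup _ hlt)
      · exact Finset.mem_insert_of_mem (hPup _ hu₁ _ hlt)
  obtain ⟨P, hPcard, -, S, L, h⟩ := hstate _ le_rfl
  have hPuniv : P = Finset.univ := (Finset.card_eq_iff_eq_univ P).1 hPcard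
  have hmem : ∀ u, u ∈ P := fun u => hPuniv ▸ Finset.mem_univ u
  have hr : (L r).Nonempty := by
    have h1 := h.card₂ r fun u _ hadj => R.root_eq_parent u hadj
    have h2 : (0 : ℝ) < (L r).card := lt_of_lt_of_le (by positivity) h1
    exact Finset.card_pos.1 (by exact_mod_cast h2)
  obtain ⟨f₁, f₂, h₁, h₂, hadj⟩ := R.exists_selection G S L hr
    (fun u => h.child u (hmem u)) (fun u => h.parent u (hmem u))
  refine ⟨f₁, f₂, fun u => h.sub₁ u (h₁ u), fun w => h.sub₂ w (h₂ w), fun u w => ⟨?_, hadj u w⟩⟩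
  intro hG
  by_contra hT
  exact h.anti u (hmem u) w hT _ (h₁ u) _ (h₂ w) hG

end Construction

end Bigraph

/-! ### Ordered blocks, and the sparse or dense pair -/

/-- Consecutive blocks of equal size in a finite set of a linear order. -/
lemma exists_ordered_blocks {α W : Type*} [LinearOrder α] [LinearOrder W] [Fintype W]
    (A : Finset α) (m : ℕ) (h : Fintype.card W * m ≤ A.card) :
    ∃ B : W → Finset α, (∀ w, B w ⊆ A) ∧ (∀ w, (B w).card = m) ∧
      ∀ w w', w < w' → ∀ a ∈ B w, ∀ b ∈ B w', a < b := by
  classical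
  let e : Fin (Fintype.card W) ≃o W := Fintype.orderIsoFinOfCardEq W rfl
  let f : Fin A.card ↪o α := A.orderEmbOfFin rfl
  have hlt : ∀ (w : W) (j : Fin m), (e.symm w : ℕ) * m + j < A.card := fun w j => by
    have h1 : (e.symm w : ℕ) + 1 ≤ Fintype.card W := (e.symm w).2
    have h2 := Nat.mul_le_mul_right m h1
    have h3 := j.2
    rw [Nat.add_mul, one_mul] at h2
    omega
  have hinj : ∀ w, Function.Injective fun j : Fin m => f ⟨(e.symm w : ℕ) * m + j, hlt w j⟩ := by
    intro w j j' hjj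
    have := congrArg Fin.val (f.injective hjj)
    simp only at this
    exact Fin.ext (by omega)
  refine ⟨fun w => Finset.univ.image fun j : Fin m => f ⟨(e.symm w : ℕ) * m + j, hlt w j⟩,
    ?_, ?_, ?_⟩
  · intro w x hx
    obtain ⟨j, -, rfl⟩ := Finset.mem_image.1 hx
    exact A.orderEmbOfFin_mem rfl _
  · intro w
    rw [Finset.card_image_of_injective _ (hinj w), Finset.card_univ, Fintype.card_fin]
  · intro w w' hww a ha b hb
    obtain ⟨j, -, rfl⟩ := Finset.mem_image.1 ha
    obtain ⟨j', -, rfl⟩ := Finset.mem_image.1 hb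
    refine f.strictMono ?_
    have h1 : (e.symm w : ℕ) + 1 ≤ e.symm w' := e.symm.strictMono hww
    have h2 := Nat.mul_le_mul_right m h1
    rw [Nat.add_mul, one_mul] at h2
    have h3 := j.2
    rw [Fin.mk_lt_mk]
    omega

namespace Bigraph

lemma contains_of_ordered_blocks {W₁ W₂ V₁ V₂ : Type*} [LinearOrder W₁] [LinearOrder W₂]
    [LinearOrder V₁] [LinearOrder V₂] {T : Bigraph W₁ W₂} {G : Bigraph V₁ V₂}
    {B₁ : W₁ → Finset V₁} {B₂ : W₂ → Finset V₂}
    (h₁ : ∀ u u', u < u' → ∀ a ∈ B₁ u, ∀ b ∈ B₁ u', a < b)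
    (h₂ : ∀ w w', w < w' → ∀ a ∈ B₂ w, ∀ b ∈ B₂ w', a < b)
    {f₁ : W₁ → V₁} {f₂ : W₂ → V₂} (hf₁ : ∀ u, f₁ u ∈ B₁ u) (hf₂ : ∀ w, f₂ w ∈ B₂ w)
    (h : ∀ u w, G.Adj (f₁ u) (f₂ w) ↔ T.Adj u w) : G.Contains T :=
  ⟨OrderEmbedding.ofStrictMono f₁ fun u u' hu => h₁ u u' hu _ (hf₁ u) _ (hf₁ u'),
    OrderEmbedding.ofStrictMono f₂ fun w w' hw => h₂ w w' hw _ (hf₂ w) _ (hf₂ w'), h⟩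

/-- A graph that does not contain `T` has linear sets `S`, `X'` such that the vertices of `X'` are
adjacent to few vertices of `S`, or to almost all of them. This is a greedy embedding: the
vertices of the second part of `T` are embedded one at a time, keeping sets of candidates for the
first part, until this is impossible because most vertices shrink some set of candidates too
much. -/
lemma exists_sparse_or_dense {W₁ W₂ V₁ V₂ : Type*} [LinearOrder W₁] [LinearOrder W₂]
    [Fintype W₁] [Fintype W₂] [LinearOrder V₁] [LinearOrder V₂] {T : Bigraph W₁ W₂}
    {G : Bigraph V₁ V₂} (hG : ¬ G.Contains T) {ε : ℝ} (hε : 0 < ε) (hε1 : ε ≤ 1) {K m : ℕ}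
    (hK : 1 ≤ K) (hm : 1 ≤ m) (hW₁ : Fintype.card W₁ ≤ K) (hW₂ : Fintype.card W₂ ≤ K)
    {A : Finset V₁} {X : Finset V₂} (hA : K * m ≤ A.card) (hX : K * m ≤ X.card) :
    ∃ S ⊆ A, ∃ X' : Finset V₂, ε ^ K * m ≤ S.card ∧ (m : ℝ) / K ≤ X'.card ∧
      ((∀ x ∈ X', ((G.nbrs₁ S x).card : ℝ) ≤ ε * S.card) ∨
        ∀ x ∈ X', ((G.bicomplement.nbrs₁ S x).card : ℝ) ≤ ε * S.card) := by
  classical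
  by_contra hcon
  obtain ⟨B₁, hB₁A, hB₁m, hB₁⟩ := exists_ordered_blocks (W := W₁) A m
    ((Nat.mul_le_mul_right m hW₁).trans hA)
  obtain ⟨B₂, hB₂X, hB₂m, hB₂⟩ := exists_ordered_blocks (W := W₂) X m
    ((Nat.mul_le_mul_right m hW₂).trans hX)
  have hm' : (1 : ℝ) ≤ m := by exact_mod_cast hm
  have key : ∀ Q : Finset W₂, ∃ (g : W₂ → V₂) (S : W₁ → Finset V₁), (∀ w, g w ∈ B₂ w) ∧
      (∀ u, S u ⊆ B₁ u) ∧ (∀ u, ε ^ Q.card * m ≤ (S u).card) ∧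
      ∀ w ∈ Q, ∀ u, ∀ s ∈ S u, (G.Adj s (g w) ↔ T.Adj u w) := by
    intro Q
    induction Q using Finset.induction_on with
    | empty =>
      have : ∀ w, ∃ x, x ∈ B₂ w := fun w =>
        Finset.card_pos.1 (by rw [hB₂m]; omega)
      choose g hg using this
      exact ⟨g, B₁, hg, fun _ => subset_rfl, fun u => by simp [hB₁m], by simp⟩
    | insert b Q hb ih =>
      obtain ⟨g, S, hg, hSB, hScard, hadj⟩ := ih
      -- the candidates for `a` that remain when `b` is mapped to `x`
      let F : W₁ → V₂ → Finset V₁ := fun a x => {s ∈ S a | G.Adj s x ↔ T.Adj a b}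
      by_cases hex : ∃ x ∈ B₂ b, ∀ a, ε * (S a).card ≤ (F a x).card
      · obtain ⟨x, hx, hF⟩ := hex
        refine ⟨Function.update g b x, fun a => F a x, ?_, fun a => (Finset.filter_subset _ _).trans
          (hSB a), ?_, ?_⟩
        · intro w
          by_cases hw : w = b
          · subst hw; simpa using hx
          · simpa [hw] using hg w
        · intro a
          rw [Finset.card_insert_of_notMem hb, pow_succ']
          refine le_trans ?_ (hF a)
          rw [mul_assoc]
          exact mul_le_mul_of_nonneg_left (hScard a) hε.le
        · intro w hw u s hs
          obtain ⟨hsS, hsF⟩ := Finset.mem_filter.1 hs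
          by_cases hwb : w = b
          · subst hwb; simpa using hsF
          · have hwQ : w ∈ Q := (Finset.mem_insert.1 hw).resolve_left hwb
            simpa [hwb] using hadj w hwQ u s hsS
      · push Not at hex
        exfalso
        have hne : Nonempty W₁ := ⟨(hex (g b) (hg b)).choose⟩
        choose! a ha using hex
        obtain ⟨u, -, hu⟩ := Finset.exists_le_card_fiber_of_nsmul_le_card_of_maps_to
          (s := B₂ b) (t := (Finset.univ : Finset W₁)) (f := a) (b := (m : ℝ) / K)
          (fun _ _ => Finset.mem_univ _) Finset.univ_nonempty (by
            have h1 : (Fintype.card W₁ : ℝ) ≤ K := by exact_mod_cast hW₁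
            have h2 : (0 : ℝ) < K := by exact_mod_cast hK
            rw [hB₂m, Finset.card_univ, nsmul_eq_mul, mul_div_assoc', div_le_iff₀ h2]
            nlinarith)
        refine hcon ⟨S u, (hSB u).trans (hB₁A u), _, ?_, hu, ?_⟩
        · refine le_trans ?_ (hScard u)
          have h1 : Q.card ≤ K := (Finset.card_le_univ Q).trans hW₂
          have := pow_le_pow_of_le_one hε.le hε1 h1
          gcongr
        · have hlt : ∀ x ∈ B₂ b, a x = u → ((F u x).card : ℝ) ≤ ε * (S u).card := by
            rintro x hx rfl
            exact (ha x hx).le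
          by_cases hT : T.Adj u b
          · left
            intro x hx
            obtain ⟨hx, hxu⟩ := Finset.mem_filter.1 hx
            convert hlt x hx hxu using 3
            ext s
            simp [F, hT]
          · right
            intro x hx
            obtain ⟨hx, hxu⟩ := Finset.mem_filter.1 hx
            convert hlt x hx hxu using 3
            ext s
            simp [F, hT, bicomplement]
  obtain ⟨g, S, hg, hSB, hScard, hadj⟩ := key Finset.univ
  have hne : ∀ u, ∃ s, s ∈ S u := fun u => Finset.card_pos.1 (by
    have : (0 : ℝ) < (S u).card := lt_of_lt_of_le (by positivity) (hScard u)
    exact_mod_cast this)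
  choose f hf using hne
  exact hG (contains_of_ordered_blocks hB₁ hB₂ (fun u => hSB u (hf u)) hg
    fun u w => hadj w (Finset.mem_univ _) u _ (hf u))

/-! ### Finding a resistant pair -/

/-- Shrinking as long as possible leads to a resistant pair, unless the degrees fall below one. -/
lemma exists_anticomplete_or_resists {V₁ V₂ : Type*} (G : Bigraph V₁ V₂) (A₀ : Finset V₁)
    (X₀ : Finset V₂) {D₀ ν : ℝ} {K M E : ℕ} (hK : 1 ≤ K) (hE : 1 ≤ E) (hν : 0 < ν) (hν1 : ν ≤ 1)
    (hD₀ : 0 < D₀)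
    (hdeg : ∀ x ∈ X₀, ((G.nbrs₁ A₀ x).card : ℝ) ≤ D₀) (hend : ν ^ (M * E) * D₀ < 1) :
    (∃ A X, (A₀.card : ℝ) ≤ (8 * K ^ 2) ^ (2 * E) * A.card ∧
      ν ^ (2 * E) * X₀.card ≤ X.card ∧ G.IsAnticomplete A X) ∨
    ∃ f < E, ∃ A X, (A₀.card : ℝ) ≤ (8 * K ^ 2) ^ f * A.card ∧ ν ^ f * X₀.card ≤ X.card ∧
      (∀ x ∈ X, ((G.nbrs₁ A x).card : ℝ) ≤ ν ^ (M * f) * D₀) ∧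
      G.Resists A X (ν ^ (M * f) * D₀) ν K M E := by
  classical
  have hK1 : (1 : ℝ) ≤ K := by exact_mod_cast hK
  have hK8 : (1 : ℝ) ≤ 8 * K ^ 2 := by nlinarith
  let P : ℕ → Prop := fun f => ∃ (A : Finset V₁) (X : Finset V₂),
    (A₀.card : ℝ) ≤ (8 * K ^ 2) ^ f * A.card ∧ ν ^ f * X₀.card ≤ X.card ∧
      ∀ x ∈ X, ((G.nbrs₁ A x).card : ℝ) ≤ ν ^ (M * f) * D₀
  by_cases hex : ∃ f, E ≤ f ∧ f ≤ 2 * E ∧ P f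
  · left
    obtain ⟨f, hEf, hf2, A, X, hA, hX, hAX⟩ := hex
    refine ⟨A, X, hA.trans ?_, le_trans ?_ hX, ?_⟩
    · gcongr
    · have := pow_le_pow_of_le_one hν.le hν1 hf2
      gcongr
    · intro a ha x hx hadj
      have h1 : (1 : ℝ) ≤ (G.nbrs₁ A x).card := by
        exact_mod_cast Finset.card_pos.2 ⟨a, mem_nbrs₁.2 ⟨ha, hadj⟩⟩
      have h2 : ν ^ (M * f) ≤ ν ^ (M * E) :=
        pow_le_pow_of_le_one hν.le hν1 (Nat.mul_le_mul_left M hEf)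
      have h3 : ν ^ (M * f) * D₀ ≤ ν ^ (M * E) * D₀ := by gcongr
      linarith [hAX x hx]
  · right
    have h0 : P 0 := ⟨A₀, X₀, by simp, by simp, by simpa using hdeg⟩
    have hf : P (Nat.findGreatest P E) := Nat.findGreatest_spec (Nat.zero_le E) h0
    have hfE : Nat.findGreatest P E ≤ E := Nat.findGreatest_le E
    set f := Nat.findGreatest P E with hfdef
    have hflt : f < E := by
      by_contra hcon
      exact hex ⟨f, by omega, by omega, hf⟩
    obtain ⟨A, X, hA, hX, hAX⟩ := hf
    refine ⟨f, hflt, A, X, hA, hX, hAX, ?_⟩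
    intro e he heE A' hA' X' hX' hAcard hXcard
    by_contra hcon
    push Not at hcon
    have hPfe : P (f + e) := by
      refine ⟨A', X', hA.trans ?_, le_trans ?_ hXcard, fun x hx => (hcon x hx).trans_eq ?_⟩
      · calc (8 * (K : ℝ) ^ 2) ^ f * (A.card : ℝ)
            ≤ (8 * (K : ℝ) ^ 2) ^ f * (8 * K ^ 2 * A'.card) := by gcongr
          _ = (8 * (K : ℝ) ^ 2) ^ (f + 1) * A'.card := by ring
          _ ≤ (8 * (K : ℝ) ^ 2) ^ (f + e) * A'.card := by gcongr
      · rw [pow_add, mul_comm (ν ^ f), mul_assoc]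
        gcongr
      · ring
    by_cases hle : f + e ≤ E
    · exact Nat.findGreatest_is_greatest (by omega : Nat.findGreatest P E < f + e) hle hPfe
    · exact hex ⟨f + e, by omega, by omega, hPfe⟩

end Bigraph

/-! ### The sparse case and the conclusion -/

namespace Bigraph

set_option maxHeartbeats 800000 in
open Filter in
/-- The sparse case: if the vertices of `X₀` have few neighbours in `A₀`, both of linear size, and
the graph does not contain the tree, then there is an anticomplete pair, linear on the first side
and of size `n ^ (1 - c)` up to a constant factor on the second. -/
lemma exists_anticomplete_of_sparse {W₁ W₂ : Type*} [LinearOrder W₁] [LinearOrder W₂] [Fintype W₁]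
    [Fintype W₂] {T : Bigraph W₁ W₂} {r : W₂} (R : T.Rooting r) {K : ℕ} (hK : 1 ≤ K)
    (hW₁ : Fintype.card W₁ ≤ K) (hW₂ : Fintype.card W₂ ≤ K) {c δ₀ : ℝ} (hc : 0 < c) (hc1 : c ≤ 1)
    (hδ₀ : 0 < δ₀) :
    ∃ δ : ℝ, 0 < δ ∧ ∃ N : ℕ, ∀ (V₁ V₂ : Type*) [LinearOrder V₁] [LinearOrder V₂]
      (G : Bigraph V₁ V₂) (n : ℕ) (A₀ : Finset V₁) (X₀ : Finset V₂), N ≤ n →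
      A₀.card ≤ n → δ₀ * n ≤ A₀.card → δ₀ * n ≤ X₀.card →
      (∀ x ∈ X₀, ((G.nbrs₁ A₀ x).card : ℝ) ≤ 1 / (16 * K ^ 3) * A₀.card) → ¬ G.Contains T →
      ∃ A X, G.IsAnticomplete A X ∧ δ * n ≤ A.card ∧ δ * (n : ℝ) ^ (1 - c) ≤ X.card := by
  have hK1 : (1 : ℝ) ≤ K := by exact_mod_cast hK
  have hK0 : (0 : ℝ) < K := by linarith
  have hK8 : (1 : ℝ) ≤ 8 * K ^ 2 := by nlinarith
  have hK3 : (1 : ℝ) ≤ (K : ℝ) ^ 3 := one_le_pow₀ hK1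
  have hK23 : (K : ℝ) ^ 2 ≤ K ^ 3 := pow_le_pow_right₀ hK1 (by norm_num)
  -- `n ^ (-4 / M)` is at least `n ^ (-c)`
  set M : ℕ := ⌈8 / c⌉₊ with hM
  have hMc : 8 / c ≤ (M : ℝ) := Nat.le_ceil _
  have hM8 : (8 : ℝ) ≤ M := le_trans (by rw [le_div_iff₀ hc]; linarith) hMc
  have hM0 : (0 : ℝ) < M := by linarith
  have hM1 : 1 ≤ M := by
    have : (1 : ℝ) ≤ M := by linarith
    exact_mod_cast this
  have h4M : 4 / (M : ℝ) ≤ c := by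
    rw [div_le_iff₀ hc] at hMc
    rw [div_le_iff₀ hM0]
    linarith
  set E : ℕ := scale M K with hEdef
  have hE1 : 1 ≤ E := one_le_scale M K
  have hE0 : (0 : ℝ) < E := by exact_mod_cast hE1
  -- with `ν = n ^ (-b)`, shrinking `E` times by `ν ^ M` brings `D` from below `n` to below one
  set b : ℝ := 2 / (M * E) with hb
  have hb0 : 0 < b := by positivity
  have hlim : Tendsto (fun n : ℕ => (n : ℝ) ^ (-b) * (128 * K ^ 3)) atTop (nhds 0) := by
    have := ((tendsto_rpow_neg_atTop hb0).comp tendsto_natCast_atTop_atTop).mul_const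
      (128 * (K : ℝ) ^ 3)
    simpa using this
  have hlim2 : Tendsto (fun n : ℕ => δ₀ * (n : ℝ) ^ (1 / 2 : ℝ)) atTop atTop :=
    ((tendsto_rpow_atTop (by norm_num : (0 : ℝ) < 1 / 2)).comp
      tendsto_natCast_atTop_atTop).const_mul_atTop hδ₀
  have hlim3 : Tendsto (fun n : ℕ => δ₀ * (n : ℝ)) atTop atTop :=
    tendsto_natCast_atTop_atTop.const_mul_atTop hδ₀
  obtain ⟨N, hN⟩ := eventually_atTop.1 (((hlim.eventually (eventually_le_nhds one_pos)).and
    (hlim2.eventually_ge_atTop (K : ℝ))).and ((hlim3.eventually_ge_atTop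
      ((8 * (K : ℝ) ^ 2) ^ E * K)).and (eventually_ge_atTop 1)))
  have hδ : 0 < δ₀ / (8 * (K : ℝ) ^ 2) ^ (2 * E) := by positivity
  refine ⟨δ₀ / (8 * (K : ℝ) ^ 2) ^ (2 * E), hδ, N, ?_⟩
  intro V₁ V₂ _ _ G n A₀ X₀ hn hA₀n hA₀ hX₀ hdeg hT
  obtain ⟨⟨hνK, hnX⟩, hnA, hn1⟩ := hN n hn
  have hn1' : (1 : ℝ) ≤ n := by exact_mod_cast hn1
  have hn0 : (0 : ℝ) < n := by linarith
  have hA₀n' : (A₀.card : ℝ) ≤ n := by exact_mod_cast hA₀n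
  set ν : ℝ := (n : ℝ) ^ (-b) with hνdef
  have hν : 0 < ν := Real.rpow_pos_of_pos hn0 _
  have hν1 : ν ≤ 1 := Real.rpow_le_one_of_one_le_of_nonpos hn1' (by linarith)
  have hνpow : ∀ k : ℕ, ν ^ k = (n : ℝ) ^ (-(b * k)) := fun k => by
    rw [hνdef, ← Real.rpow_natCast, ← Real.rpow_mul hn0.le, neg_mul]
  have hνME : ν ^ (M * E) = (n : ℝ) ^ (-2 : ℝ) := by
    rw [hνpow, hb]; push_cast; congr 1; field_simp
  have hνE : ν ^ E = (n : ℝ) ^ (-(2 / M : ℝ)) := by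
    rw [hνpow, hb]; congr 1; field_simp
  have hν2E : ν ^ (2 * E) = (n : ℝ) ^ (-(4 / M : ℝ)) := by
    rw [hνpow, hb]; push_cast; congr 1; field_simp; norm_num
  have hA₀pos : (0 : ℝ) < A₀.card := lt_of_lt_of_le (by positivity) hA₀
  set D₀ : ℝ := 1 / (16 * K ^ 3) * A₀.card with hD₀
  have hD₀pos : 0 < D₀ := by positivity
  have hend : ν ^ (M * E) * D₀ < 1 := by
    rw [hνME, Real.rpow_neg hn0.le, Real.rpow_two]
    have h1 : 1 / (16 * (K : ℝ) ^ 3) < 1 := by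
      rw [div_lt_one (by positivity)]; linarith
    have h2 : D₀ < n := by
      rw [hD₀]
      calc 1 / (16 * (K : ℝ) ^ 3) * A₀.card < 1 * A₀.card := by gcongr
        _ ≤ n := by linarith
    rw [inv_mul_lt_iff₀ (by positivity)]
    nlinarith
  rcases G.exists_anticomplete_or_resists A₀ X₀ hK hE1 hν hν1 hD₀pos hdeg hend with
    ⟨A, X, hA, hX, hAX⟩ | ⟨f, hfE, A, X, hA, hX, hAXdeg, hres⟩
  · refine ⟨A, X, hAX, ?_, ?_⟩
    · rw [div_mul_eq_mul_div, div_le_iff₀ (by positivity)]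
      linarith
    · refine le_trans ?_ hX
      have h1 : (1 : ℝ) ≤ (8 * (K : ℝ) ^ 2) ^ (2 * E) := one_le_pow₀ hK8
      have h2 : (n : ℝ) ^ (1 - c) ≤ ν ^ (2 * E) * n := by
        rw [hν2E]
        nth_rewrite 3 [← Real.rpow_one (n : ℝ)]
        rw [← Real.rpow_add hn0]
        exact Real.rpow_le_rpow_of_exponent_le hn1' (by linarith)
      calc δ₀ / (8 * (K : ℝ) ^ 2) ^ (2 * E) * (n : ℝ) ^ (1 - c)
          ≤ δ₀ * (ν ^ (2 * E) * n) := by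
            gcongr
            exact div_le_self hδ₀.le h1
        _ = ν ^ (2 * E) * (δ₀ * n) := by ring
        _ ≤ ν ^ (2 * E) * X₀.card := by gcongr
  · exfalso
    have hν8 : ν * (8 * K ^ 2) ≤ 1 := by nlinarith
    have hAK : K ≤ A.card := by
      have h1 : (8 * (K : ℝ) ^ 2) ^ f ≤ (8 * (K : ℝ) ^ 2) ^ E :=
        pow_le_pow_right₀ hK8 hfE.le
      have h2 : (8 * (K : ℝ) ^ 2) ^ E * K ≤ (8 * (K : ℝ) ^ 2) ^ E * A.card := by
        calc _ ≤ δ₀ * n := hnA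
          _ ≤ _ := hA₀
          _ ≤ _ := hA
          _ ≤ _ := by gcongr
      have h3 := le_of_mul_le_mul_left h2 (by positivity)
      exact_mod_cast h3
    have hXK : K ≤ X.card := by
      have h1 : ν ^ E ≤ ν ^ f := pow_le_pow_of_le_one hν.le hν1 hfE.le
      have h2 : (n : ℝ) ^ (1 / 2 : ℝ) ≤ ν ^ E * n := by
        rw [hνE]
        nth_rewrite 3 [← Real.rpow_one (n : ℝ)]
        rw [← Real.rpow_add hn0]
        refine Real.rpow_le_rpow_of_exponent_le hn1' ?_
        have : 2 / (M : ℝ) ≤ 1 / 2 := by rw [div_le_iff₀ hM0]; linarith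
        linarith
      have h3 : (K : ℝ) ≤ X.card := by
        calc (K : ℝ) ≤ δ₀ * (n : ℝ) ^ (1 / 2 : ℝ) := hnX
          _ ≤ δ₀ * (ν ^ E * n) := by gcongr
          _ = ν ^ E * (δ₀ * n) := by ring
          _ ≤ ν ^ f * X₀.card := by gcongr
          _ ≤ _ := hX
      exact_mod_cast h3
    have hDA : 16 * K ^ 3 * (ν ^ (M * f) * D₀) ≤ A.card := by
      have h1 : 16 * K ^ 3 * (ν ^ (M * f) * D₀) = ν ^ (M * f) * A₀.card := by
        rw [hD₀]; field_simp
      have h2 : ν ^ (M * f) ≤ ν ^ f :=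
        pow_le_pow_of_le_one hν.le hν1 (Nat.le_mul_of_pos_left f hM1)
      rw [h1]
      calc ν ^ (M * f) * A₀.card ≤ ν ^ f * ((8 * K ^ 2) ^ f * A.card) := by gcongr
        _ = (ν * (8 * K ^ 2)) ^ f * A.card := by rw [← mul_assoc, ← mul_pow]
        _ ≤ 1 * A.card := by
          gcongr
          exact pow_le_one₀ (by positivity) hν8
        _ = _ := one_mul _
    have hblock : ∀ {s : ℕ}, K ≤ s → s ≤ 2 * K * (s / K) := by
      intro s hs
      have h1 : 1 ≤ s / K := Nat.div_pos hs hK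
      have h2 := Nat.div_add_mod s K
      have h3 := Nat.mod_lt s hK
      nlinarith
    obtain ⟨S₀, hS₀, hS₀c, hS₀lt⟩ := exists_ordered_blocks (W := W₁) A (A.card / K)
      ((Nat.mul_le_mul_right _ hW₁).trans (Nat.mul_div_le _ _))
    obtain ⟨L₀, hL₀, hL₀c, hL₀lt⟩ := exists_ordered_blocks (W := W₂) X (X.card / K)
      ((Nat.mul_le_mul_right _ hW₂).trans (Nat.mul_div_le _ _))
    obtain ⟨f₁, f₂, hf₁, hf₂, hadj⟩ := R.exists_copy hres hK (by positivity) hν hνK hAXdeg hDA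
      (Finset.card_pos.1 (by omega)) hW₁ hW₂ le_rfl hS₀ hL₀
      (fun u => by rw [hS₀c]; exact hblock hAK) (fun w => by rw [hL₀c]; exact hblock hXK)
    exact hT (contains_of_ordered_blocks hS₀lt hL₀lt hf₁ hf₂ hadj)

/-- A tree bigraph whose second part is empty is a single vertex. -/
lemma IsTree.subsingleton_of_isEmpty {W₁ W₂ : Type*} {T : Bigraph W₁ W₂} (hT : T.IsTree)
    [IsEmpty W₂] : Subsingleton W₁ := by
  refine ⟨fun u u' => ?_⟩
  obtain ⟨p⟩ := hT.connected.preconnected (Sum.inl u) (Sum.inl u')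
  cases p with
  | nil => rfl
  | @cons _ v _ h _ =>
    rcases v with v | v
    · exact h.elim
    · exact isEmptyElim v

end Bigraph

theorem mainTheorem4 {W₁ W₂ : Type*} [LinearOrder W₁] [LinearOrder W₂] [Fintype W₁] [Fintype W₂]
    (T : Bigraph W₁ W₂) (hT : T.IsTree) (c : ℝ) (hc : 0 < c) :
    ∃ δ : ℝ, 0 < δ ∧
      ∀ (V₁ V₂ : Type*) [LinearOrder V₁] [LinearOrder V₂] [Fintype V₁] [Fintype V₂]
        (G : Bigraph V₁ V₂) (n : ℕ), 1 ≤ n → n ≤ Fintype.card V₁ → n ≤ Fintype.card V₂ →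
        ¬ G.Contains T → ¬ G.Contains T.bicomplement →
        ∃ (Z₁ : Finset V₁) (Z₂ : Finset V₂), G.IsPure Z₁ Z₂ ∧
          ((δ * (n : ℝ) ≤ (Z₁.card : ℝ) ∧ δ * (n : ℝ) ^ (1 - c) ≤ (Z₂.card : ℝ)) ∨
            (δ * (n : ℝ) ^ (1 - c) ≤ (Z₁.card : ℝ) ∧ δ * (n : ℝ) ≤ (Z₂.card : ℝ))) := by
  rcases isEmpty_or_nonempty W₂ with hW | ⟨⟨r⟩⟩
  · have := hT.subsingleton_of_isEmpty
    refine ⟨1, one_pos, fun V₁ V₂ _ _ _ _ G n hn hV₁ _ hG _ => (hG ?_).elim⟩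
    obtain ⟨v⟩ : Nonempty V₁ := Fintype.card_pos_iff.1 (by omega)
    exact ⟨OrderEmbedding.ofStrictMono (fun _ => v)
      fun a b h => absurd (Subsingleton.elim a b) h.ne,
      OrderEmbedding.ofStrictMono (fun b => isEmptyElim b) fun b => isEmptyElim b,
      fun _ b => isEmptyElim b⟩
  obtain ⟨R⟩ := hT.nonempty_rooting r
  set K : ℕ := Fintype.card W₁ + Fintype.card W₂ with hKdef
  have hK : 1 ≤ K := by
    have : 0 < Fintype.card W₂ := Fintype.card_pos_iff.2 ⟨r⟩
    omega
  have hK1 : (1 : ℝ) ≤ K := by exact_mod_cast hK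
  set ε : ℝ := 1 / (16 * K ^ 3) with hε
  have hK3 : (1 : ℝ) ≤ (K : ℝ) ^ 3 := one_le_pow₀ hK1
  have hε0 : 0 < ε := by positivity
  have hε1 : ε ≤ 1 := by
    rw [hε, div_le_one (by positivity)]; linarith
  have hεK : ε ^ K ≤ 1 := pow_le_one₀ hε0.le hε1
  set δ₀ : ℝ := ε ^ K / (2 * K ^ 2) with hδ₀def
  have hδ₀ : 0 < δ₀ := by positivity
  obtain ⟨δ, hδ, N, hmain⟩ := Bigraph.exists_anticomplete_of_sparse R hK (by omega) (by omega)
    (lt_min hc one_pos) (min_le_right c 1) hδ₀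
  set N' : ℕ := max N K with hN'
  have hN'0 : (0 : ℝ) < N' := by
    have : 1 ≤ N' := hK.trans (le_max_right _ _)
    exact_mod_cast this
  refine ⟨min δ (1 / N'), lt_min hδ (by positivity), ?_⟩
  intro V₁ V₂ _ _ _ _ G n hn hV₁ hV₂ hG hG'
  have hn1 : (1 : ℝ) ≤ n := by exact_mod_cast hn
  rcases le_total N' n with hNn | hnN
  · obtain ⟨A, -, hA⟩ := Finset.exists_subset_card_eq (s := (Finset.univ : Finset V₁)) hV₁
    obtain ⟨X, -, hX⟩ := Finset.exists_subset_card_eq (s := (Finset.univ : Finset V₂)) hV₂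
    have hKn : K ≤ n := (le_max_right _ _).trans hNn
    have hm : 1 ≤ n / K := Nat.div_pos hKn hK
    obtain ⟨S, hSA, X', hS, hX', hdeg⟩ := Bigraph.exists_sparse_or_dense hG hε0 hε1 hK hm
      (by omega) (by omega) (A := A) (X := X) (by rw [hA]; exact Nat.mul_div_le _ _)
      (by rw [hX]; exact Nat.mul_div_le _ _)
    have hm2 : (n : ℝ) ≤ 2 * K * (n / K : ℕ) := by
      have h2 := Nat.div_add_mod n K
      have h3 := Nat.mod_lt n hK
      have : n ≤ 2 * K * (n / K) := by nlinarith
      exact_mod_cast this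
    have hS₀ : δ₀ * n ≤ S.card := by
      refine le_trans ?_ hS
      rw [hδ₀def, div_mul_eq_mul_div, div_le_iff₀ (by positivity), mul_assoc]
      have : (n / K : ℕ) * (2 * (K : ℝ)) ≤ (n / K : ℕ) * (2 * (K : ℝ) ^ 2) := by
        gcongr; nlinarith
      gcongr
      linarith
    have hX₀ : δ₀ * n ≤ X'.card := by
      refine le_trans ?_ hX'
      rw [hδ₀def, div_mul_eq_mul_div, div_le_div_iff₀ (by positivity) (by linarith)]
      calc ε ^ K * n * K ≤ 1 * (2 * K * (n / K : ℕ)) * K := by gcongr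
        _ = _ := by ring
    have hSn : S.card ≤ n := hA ▸ Finset.card_le_card hSA
    have hfin : ∀ {Z₁ : Finset V₁} {Z₂ : Finset V₂}, δ * n ≤ Z₁.card →
        δ * (n : ℝ) ^ (1 - min c 1) ≤ Z₂.card → min δ (1 / N') * (n : ℝ) ≤ Z₁.card ∧
          min δ (1 / N') * (n : ℝ) ^ (1 - c) ≤ Z₂.card := by
      intro Z₁ Z₂ h1 h2
      refine ⟨le_trans ?_ h1, le_trans ?_ h2⟩
      · gcongr; exact min_le_left _ _
      · have : (n : ℝ) ^ (1 - c) ≤ (n : ℝ) ^ (1 - min c 1) :=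
          Real.rpow_le_rpow_of_exponent_le hn1 (by linarith [min_le_left c 1])
        gcongr; exact min_le_left _ _
    rcases hdeg with hdeg | hdeg
    · obtain ⟨Z₁, Z₂, hZ, h1, h2⟩ := hmain V₁ V₂ G n S X' ((le_max_left _ _).trans hNn) hSn hS₀
        hX₀ hdeg hG
      exact ⟨Z₁, Z₂, Or.inr hZ, Or.inl (hfin h1 h2)⟩
    · obtain ⟨Z₁, Z₂, hZ, h1, h2⟩ := hmain V₁ V₂ G.bicomplement n S X'
        ((le_max_left _ _).trans hNn) hSn hS₀ hX₀ hdeg (by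
          rintro ⟨f₁, f₂, h⟩
          exact hG' ⟨f₁, f₂, fun a b => not_iff_comm.1 (h a b) |>.symm⟩)
      exact ⟨Z₁, Z₂, Or.inl fun a ha b hb => not_not.1 (hZ a ha b hb), Or.inl (hfin h1 h2)⟩
  · -- for bounded `n` any two vertices form a sufficiently large pure pair
    obtain ⟨v₁⟩ : Nonempty V₁ := Fintype.card_pos_iff.1 (by omega)
    obtain ⟨v₂⟩ : Nonempty V₂ := Fintype.card_pos_iff.1 (by omega)
    have h1 : min δ (1 / N') * (n : ℝ) ≤ 1 := by
      have h2 : (n : ℝ) ≤ N' := by exact_mod_cast hnN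
      calc min δ (1 / N') * (n : ℝ) ≤ 1 / N' * N' := by
            gcongr; exact min_le_right _ _
        _ = 1 := by field_simp
    have h2 : min δ (1 / N') * (n : ℝ) ^ (1 - c) ≤ 1 := by
      refine le_trans ?_ h1
      have h3 : (n : ℝ) ^ (1 - c) ≤ n := by
        conv_rhs => rw [← Real.rpow_one (n : ℝ)]
        exact Real.rpow_le_rpow_of_exponent_le hn1 (by linarith)
      have h4 : 0 ≤ min δ (1 / (N' : ℝ)) := (lt_min hδ (by positivity)).le
      gcongr
    refine ⟨{v₁}, {v₂}, ?_, Or.inl ⟨by simpa using h1, by simpa using h2⟩⟩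
    by_cases h : G.Adj v₁ v₂
    · exact Or.inl fun a ha b hb => by
        rw [Finset.mem_singleton.1 ha, Finset.mem_singleton.1 hb]; exact h
    · exact Or.inr fun a ha b hb => by
        rw [Finset.mem_singleton.1 ha, Finset.mem_singleton.1 hb]; exact h
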